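/- Let $X$ be a complex K3 surface, i.e. a smooth projective connected surface over $\mathbb C$ with $\omega_X\cong\mathcal O_X$ and $H^1(X,\mathcal O_X)=0$. Fix integers $r\ge 0$, $v\ge 1$ and Chern classes $c_1,c_2$. A coherent sheaf $M$ on $X$ is called simple if the natural map $H^0(X,\mathcal O_X)\to \mathrm{End}(M)$ is an isomorphism, and $\mathrm{Spl}(r;c_1,c_2)$ denotes the moduli space of simple coherent sheaves of rank $r$ with Chern classes $c_1,c_2$; its points are the isomorphism classes of such sheaves. Let $U_e\subset \mathrm{Spl}(r;c_1,c_2)$ be the locus of simple vector bundles $F$ of rank $r$ with $H^0(F)=H^0(F^*)=0$, and let $\mathcal P_{U_e}$ be the moduli space whose points are the pairs $(F,V)$, where $F\in U_e$ and $V$ is the dual of a $v$-dimensional subspace $V^*\subset H^1(X,F^*)\cong \mathrm{Ext}^1(F,\mathcal O_X)$; pairs $(F,V)$ and $(F',V')$ are identified if there is an isomorphism $\varphi:F\to F'$ such that $\varphi^*$ carries $V'^*$ onto $V^*$. An extension bundle associated to $(F,V)$ is the middle term $E$ of an extension $$0\to V\otimes\mathcal O_X\xrightarrow{\ i\ } E\xrightarrow{\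 p\ } F\to 0$$ whose class in $\mathrm{Ext}^1(F,V\otimes \mathcal O_X)=\mathrm{Hom}(V^*,H^1(F^*))$ is the inclusion $V^*\hookrightarrow H^1(F^*)$. Then every $(F,V)$ as above has an associated extension bundle $E$. It is a vector bundle of rank $r+v$, and its isomorphism class is a point of $\mathrm{Spl}(r+v;c_1,c_2)$ that depends only on the point $(F,V)$ of $\mathcal P_{U_e}$. The resulting map on points $$\beta:\mathcal P_{U_e}\to \mathrm{Spl}(r+v;c_1,c_2),\qquad (F,V)\mapsto E,$$ is injective. Moreover, for every such extension, $i$ induces an isomorphism $V\cong H^0(E)$, the evaluation map $H^0(E)\otimes\mathcal O_X\to E$ is injective, and $p:E\to F$ is its cokernel. -/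

import Mathlib

open CategoryTheory CategoryTheory.Limits CategoryTheory.Abelian AlgebraicGeometry

noncomputable section

namespace K3Ext

/-! ## Sheaves of modules on complex schemes -/

/-- The base scheme `Spec ℂ`. -/
abbrev SpecC : Scheme.{0} := Spec (CommRingCat.of ℂ)

/-- The structure sheaf `𝒪_X`, as a sheaf of modules over itself. -/
abbrev structureSheaf (X : Scheme.{0}) : X.Modules := SheafOfModules.unit X.ringCatSheaf

/-- The trivial bundle `𝒪_X^n`. -/
abbrev trivialBundle (X : Scheme.{0}) (n : ℕ) : X.Modules := ∐ fun _ : Fin n => structureSheaf X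

/-- Multiplication by a global function `a` on a sheaf of modules `M`. -/
def globalSMul {X : Scheme.{0}} (M : X.Modules) (a : Γ(X, ⊤)) : M ⟶ M where
  val :=
    { app := fun U => ModuleCat.ofHom (X := M.val.obj U) (Y := M.val.obj U)
        { toFun := fun x => (X.presheaf.map (homOfLE (le_top : U.unop ≤ ⊤)).op a : Γ(X, U.unop)) •
            (show Γ(M, U.unop) from x)
          map_add' := fun x y => smul_add (M := Γ(X, U.unop)) (A := Γ(M, U.unop)) _ _ _
          map_smul' := fun b x =>
            smul_comm (M := Γ(X, U.unop)) (N := Γ(X, U.unop)) (α := Γ(M, U.unop)) _ _ _ }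
      naturality := by
        intro U V f
        ext x
        have h1 := Scheme.Modules.map_smul M f.unop
          (X.presheaf.map (homOfLE (le_top : U.unop ≤ ⊤)).op a) x
        have h2 : X.presheaf.map f (X.presheaf.map (homOfLE (le_top : U.unop ≤ ⊤)).op a)
            = X.presheaf.map (homOfLE (le_top : V.unop ≤ ⊤)).op a := by
          rw [← ConcreteCategory.comp_apply, ← Functor.map_comp]; rfl
        refine Eq.trans ?_ h1.symm
        erw [h2]
        rfl }

lemma globalSMul_app {X : Scheme.{0}} (M : X.Modules) (a : Γ(X, ⊤)) (U : X.Opens) (x : Γ(M, U)) :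
    (globalSMul M a).app U x = X.presheaf.map (homOfLE (le_top : U ≤ ⊤)).op a • x := rfl

lemma globalSMul_comm {X : Scheme.{0}} {M N : X.Modules} (f : M ⟶ N) (a : Γ(X, ⊤)) :
    globalSMul M a ≫ f = f ≫ globalSMul N a := by
  ext U x
  simp [globalSMul_app]

/-- The natural ring homomorphism `H⁰(X, 𝒪_X) → End(M)`. -/
def globalSMulHom {X : Scheme.{0}} (M : X.Modules) : Γ(X, ⊤) →+* End M where
  toFun := globalSMul M
  map_one' := by
    change _ = 𝟙 M
    ext U x; simp [globalSMul_app]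
  map_zero' := by
    change _ = (0 : M ⟶ M)
    ext U x; simp [globalSMul_app]
  map_add' a b := by
    change _ = (globalSMul M a + globalSMul M b : M ⟶ M)
    ext U x; simp [globalSMul_app, add_smul]
  map_mul' a b := by
    change _ = globalSMul M b ≫ globalSMul M a
    ext U x
    rw [globalSMul_app, map_mul, mul_smul, Scheme.Modules.Hom.comp_app]
    rfl

/-- The structure homomorphism `ℂ → H⁰(X, 𝒪_X)` of a complex scheme. -/
def scalars (X : Scheme.{0}) [X.Over SpecC] : ℂ →+* Γ(X, ⊤) :=
  ((Scheme.ΓSpecIso (CommRingCat.of ℂ)).inv ≫ (X ↘ SpecC).appTop).hom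

/-- The category of sheaves of modules on a complex scheme is `ℂ`-linear: a scalar acts through its
image in `H⁰(X, 𝒪_X)`. -/
instance linearModules (X : Scheme.{0}) [X.Over SpecC] : Linear ℂ X.Modules where
  homModule M N :=
    { smul := fun c f => f ≫ globalSMulHom N (scalars X c)
      one_smul := fun f => by
        change f ≫ globalSMulHom N (scalars X 1) = f
        rw [map_one, map_one]; exact Category.comp_id f
      mul_smul := fun a b f => by
        change f ≫ globalSMulHom N (scalars X (a * b)) =
          (f ≫ globalSMulHom N (scalars X b)) ≫ globalSMulHom N (scalars X a)
        rw [map_mul, map_mul, Category.assoc]; rfl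
      smul_zero := fun a => zero_comp
      smul_add := fun a f g => Preadditive.add_comp _ _ _ _ _ _
      add_smul := fun a b f => by
        change f ≫ globalSMulHom N (scalars X (a + b)) =
          f ≫ globalSMulHom N (scalars X a) + f ≫ globalSMulHom N (scalars X b)
        rw [map_add, map_add]; exact Preadditive.comp_add _ _ _ _ _ _
      zero_smul := fun f => by
        change f ≫ globalSMulHom N (scalars X 0) = 0
        rw [map_zero, map_zero]; exact comp_zero }
  smul_comp M N K c f g := by
    change (f ≫ globalSMul N (scalars X c)) ≫ g = (f ≫ g) ≫ globalSMul K (scalars X c)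
    rw [Category.assoc, globalSMul_comm, Category.assoc]
  comp_smul M N K f c g := (Category.assoc _ _ _).symm

/-- `Ext`-groups of sheaves of modules. -/
instance hasExtModules (X : Scheme.{0}) : HasExt.{1} X.Modules := HasExt.standard X.Modules

/-- `H⁰(X, M)`, in the form `Hom(𝒪_X, M)`; see `globalSectionsEquiv`. -/
abbrev H0 {X : Scheme.{0}} (M : X.Modules) : Type := structureSheaf X ⟶ M

/-- A morphism `f : 𝒪_X ⟶ M` is the same as the global section `f(1)` of `M`. -/
def globalSectionsEquiv {X : Scheme.{0}} (M : X.Modules) : H0 M ≃+ Γ(M, ⊤) where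
  toFun f := f.app ⊤ (1 : Γ(X, ⊤))
  invFun s := (SheafOfModules.unitHomEquiv M).symm
    (PresheafOfModules.sectionsMk (fun U => M.presheaf.map (homOfLE (le_top : U.unop ≤ ⊤)).op s)
      (by
        intro U V f
        change M.presheaf.map f (M.presheaf.map _ s) = _
        rw [← ConcreteCategory.comp_apply, ← Functor.map_comp]; rfl))
  left_inv f := by
    apply (SheafOfModules.unitHomEquiv M).injective
    rw [Equiv.apply_symm_apply]
    apply PresheafOfModules.sections_ext
    intro U
    exact ((SheafOfModules.unitHomEquiv M) f).2 (homOfLE (le_top : U.unop ≤ ⊤)).op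
  right_inv s := by
    have h := congrArg (fun t => t.1 (Opposite.op ⊤))
      ((SheafOfModules.unitHomEquiv M).apply_symm_apply
        (PresheafOfModules.sectionsMk (fun U => M.presheaf.map (homOfLE (le_top : U.unop ≤ ⊤)).op s)
          (by
            intro U V f
            change M.presheaf.map f (M.presheaf.map _ s) = _
            rw [← ConcreteCategory.comp_apply, ← Functor.map_comp]; rfl)))
    refine h.trans ?_
    change M.presheaf.map (𝟙 _) s = s
    simp
  map_add' f g := rfl

/-! ## K3 surfaces -/

/-- The restriction maps of a presheaf of modules, as functions. -/
def restrictMap {C : Type} [Category.{0} C] {R : Cᵒᵖ ⥤ CommRingCat.{0}}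
    (M : PresheafOfModules.{0} (R ⋙ forget₂ CommRingCat RingCat)) {U V : Cᵒᵖ} (f : U ⟶ V)
    (x : M.obj U) : M.obj V := M.map f x

/-- Restriction of families of sections. -/
def restrictFamily {C : Type} [Category.{0} C] {R : Cᵒᵖ ⥤ CommRingCat.{0}}
    (M : PresheafOfModules.{0} (R ⋙ forget₂ CommRingCat RingCat)) (n : ℕ) {U V : Cᵒᵖ} (f : U ⟶ V)
    (x : Fin n → M.obj U) : Fin n → M.obj V := fun i => restrictMap M f (x i)

lemma restrictFamily_update {C : Type} [Category.{0} C] {R : Cᵒᵖ ⥤ CommRingCat.{0}}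
    (M : PresheafOfModules.{0} (R ⋙ forget₂ CommRingCat RingCat)) (n : ℕ) {U V : Cᵒᵖ} (f : U ⟶ V)
    [DecidableEq (Fin n)] (x : Fin n → M.obj U) (i : Fin n) (z : M.obj U) :
    restrictFamily M n f (Function.update x i z) =
      Function.update (restrictFamily M n f x) i (restrictMap M f z) :=
  funext fun j => Function.apply_update (fun _ => restrictMap M f) x i z j

/-- Restriction maps of the presheaf `U ↦ ⋀ⁿ M(U)`. -/
def exteriorMap {C : Type} [Category.{0} C] {R : Cᵒᵖ ⥤ CommRingCat.{0}}
    (M : PresheafOfModules.{0} (R ⋙ forget₂ CommRingCat RingCat)) (n : ℕ) {U V : Cᵒᵖ} (f : U ⟶ V) :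
    ModuleCat.exteriorPower (R := R.obj U) (M.obj U) n ⟶
      (ModuleCat.restrictScalars (R.map f).hom).obj
        (ModuleCat.exteriorPower (R := R.obj V) (M.obj V) n) :=
  ModuleCat.exteriorPower.desc
    { toFun := fun x =>
        ModuleCat.exteriorPower.mk (R := R.obj V) (M := M.obj V) (restrictFamily M n f x)
      map_update_add' := by
        intro _ x i a b
        simp only [restrictFamily_update]
        rw [show restrictMap M f (a + b) = restrictMap M f a + restrictMap M f b from
          map_add (M.map f).hom a b]
        exact (exteriorPower.ιMulti (R.obj V) n (M := M.obj V)).map_update_add _ _ _ _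
      map_update_smul' := by
        intro _ x i c a
        simp only [restrictFamily_update]
        rw [show restrictMap M f (c • a) = (R.map f c : R.obj V) • restrictMap M f a from
          M.map_smul f c a]
        exact (exteriorPower.ιMulti (R.obj V) n (M := M.obj V)).map_update_smul _ _ _ _
      map_eq_zero_of_eq' := by
        intro x i j h hij
        exact (exteriorPower.ιMulti (R.obj V) n (M := M.obj V)).map_eq_zero_of_eq _
          (congrArg (restrictMap M f) h) hij }

lemma exteriorMap_mk {C : Type} [Category.{0} C] {R : Cᵒᵖ ⥤ CommRingCat.{0}}
    (M : PresheafOfModules.{0} (R ⋙ forget₂ CommRingCat RingCat)) (n : ℕ) {U V : Cᵒᵖ} (f : U ⟶ V)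
    (x : Fin n → M.obj U) :
    exteriorMap M n f (ModuleCat.exteriorPower.mk (R := R.obj U) (M := M.obj U) x) =
      ModuleCat.exteriorPower.mk (R := R.obj V) (M := M.obj V) (restrictFamily M n f x) :=
  ModuleCat.exteriorPower.desc_mk (R := R.obj U) (M := M.obj U) _ x

/-- The presheaf of modules `U ↦ ⋀ⁿ M(U)`. -/
def exteriorPresheaf {C : Type} [Category.{0} C] {R : Cᵒᵖ ⥤ CommRingCat.{0}}
    (M : PresheafOfModules.{0} (R ⋙ forget₂ CommRingCat RingCat)) (n : ℕ) :
    PresheafOfModules.{0} (R ⋙ forget₂ CommRingCat RingCat) where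
  obj U := ModuleCat.exteriorPower (R := R.obj U) (M.obj U) n
  map f := exteriorMap M n f
  map_id U := by
    apply ModuleCat.exteriorPower.hom_ext
    apply ModuleCat.AlternatingMap.ext
    intro x
    refine (exteriorMap_mk M n (𝟙 U) x).trans ?_
    rw [show restrictFamily M n (𝟙 U) x = x from funext fun i => by
      simp only [restrictFamily, restrictMap, PresheafOfModules.map_id]; rfl]
    rfl
  map_comp f g := by
    apply ModuleCat.exteriorPower.hom_ext
    apply ModuleCat.AlternatingMap.ext
    intro x
    refine (exteriorMap_mk M n (f ≫ g) x).trans ?_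
    rw [show restrictFamily M n (f ≫ g) x = restrictFamily M n g (restrictFamily M n f x) from
      funext fun i => M.map_comp_apply f g (x i)]
    refine (exteriorMap_mk M n g _).symm.trans ?_
    refine congrArg (exteriorMap M n g) (exteriorMap_mk M n f x).symm

/-- The inclusion of the constant functions into the structure presheaf of a complex scheme. -/
def constants (X : Scheme.{0}) [X.Over SpecC] :
    (Functor.const (TopologicalSpace.Opens X)ᵒᵖ).obj (CommRingCat.of ℂ) ⟶ X.presheaf where
  app U := CommRingCat.ofHom
    ((X.presheaf.map (homOfLE (le_top : U.unop ≤ ⊤)).op).hom.comp (scalars X))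
  naturality U V f := by
    ext c
    change X.presheaf.map _ (scalars X c) = X.presheaf.map f (X.presheaf.map _ (scalars X c))
    rw [← ConcreteCategory.comp_apply, ← Functor.map_comp]; rfl

/-- The presheaf of Kähler differentials `U ↦ Ω_{𝒪(U)/ℂ}`. -/
def differentials (X : Scheme.{0}) [X.Over SpecC] :
    PresheafOfModules.{0} (X.presheaf ⋙ forget₂ CommRingCat RingCat) :=
  PresheafOfModules.DifferentialsConstruction.relativeDifferentials' (constants X)

/-- The canonical sheaf `⋀² Ω_{X/ℂ}` of a surface. -/
def canonicalSheaf (X : Scheme.{0}) [X.Over SpecC] : X.Modules :=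
  (PresheafOfModules.sheafification (𝟙 X.ringCatSheaf.obj)).obj
    (exteriorPresheaf (differentials X) 2)

attribute [local instance] MvPolynomial.gradedAlgebra

/-- Projective space over `ℂ`. -/
abbrev ProjSpace (n : ℕ) : Scheme.{0} := Proj (MvPolynomial.homogeneousSubmodule (Fin (n + 1)) ℂ)

/-- The structure morphism of projective space. -/
def projSpaceToSpec (n : ℕ) : ProjSpace n ⟶ SpecC :=
  Proj.toSpecZero (MvPolynomial.homogeneousSubmodule (Fin (n + 1)) ℂ) ≫
    Spec.map (CommRingCat.ofHom
      (algebraMap ℂ (MvPolynomial.homogeneousSubmodule (Fin (n + 1)) ℂ 0)))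

/-- A K3 surface: a smooth projective connected complex surface with trivial canonical bundle and
vanishing irregularity `h¹(𝒪_X)`. -/
class IsK3 (X : Scheme.{0}) [X.Over SpecC] : Prop where
  smooth : SmoothOfRelativeDimension 2 (X ↘ SpecC)
  projective : ∃ (n : ℕ) (j : X ⟶ ProjSpace n),
    IsClosedImmersion j ∧ j ≫ projSpaceToSpec n = X ↘ SpecC
  connected : ConnectedSpace X
  canonical_trivial : Nonempty (canonicalSheaf X ≅ structureSheaf X)
  irregularity : Subsingleton (((SheafOfModules.toSheaf _).obj (structureSheaf X)).H 1)

/-! ## Coherent sheaves and their invariants -/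

/-- Coherent sheaves. (The schemes considered here are Noetherian, so that coherent means finitely
presented.) -/
abbrev Coh (X : Scheme.{0}) : Type 1 := {M : X.Modules // SheafOfModules.IsFinitePresentation M}

lemma structureSheaf_isFinitePresentation (X : Scheme.{0}) :
    SheafOfModules.IsFinitePresentation (structureSheaf X : SheafOfModules X.ringCatSheaf) := by
  let q := (SheafOfModules.free.generatingSections
    (R := X.ringCatSheaf) PUnit.{1}).localGeneratorsData.quasiCoherentData
  have hq : q.IsFinitePresentation :=
    { isFinite_presentation := fun i =>
        { isFiniteType_generators := ⟨inferInstanceAs (Finite PUnit)⟩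
          isFiniteType_relations := ⟨inferInstanceAs (Finite (ULift Empty))⟩ } }
  let φ : SheafOfModules.free (R := X.ringCatSheaf) PUnit.{1} ≅ SheafOfModules.unit X.ringCatSheaf :=
    coproductUniqueIso fun _ : PUnit.{1} => SheafOfModules.unit X.ringCatSheaf
  exact ⟨q.ofIsIso φ.hom, inferInstance⟩

/-- The structure sheaf as a coherent sheaf. -/
def structureCoh (X : Scheme.{0}) : Coh X :=
  ⟨structureSheaf X, structureSheaf_isFinitePresentation X⟩

/-- `M` is a vector bundle of rank `r`: it is locally isomorphic to `𝒪^r`. -/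
def IsVectorBundle {X : Scheme.{0}} (M : X.Modules) (r : ℕ) : Prop :=
  ∀ x : X, ∃ U : X.Opens, x ∈ U ∧ Nonempty (M.restrict U.ι ≅ trivialBundle U r)

/-- `M` has (generic) rank `r`: it is isomorphic to `𝒪^r` on some non-empty open set. This is the
rank of a coherent sheaf on an integral scheme. -/
def HasRank {X : Scheme.{0}} (M : X.Modules) (r : ℕ) : Prop :=
  ∃ U : X.Opens, (∃ x : X, x ∈ U) ∧ Nonempty (M.restrict U.ι ≅ trivialBundle U r)

/-- `M` is simple: the natural map `H⁰(X, 𝒪_X) → End(M)` is an isomorphism. -/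
def IsSimple {X : Scheme.{0}} (M : X.Modules) : Prop := Function.Bijective (globalSMulHom M)

/-- The relations `[B] = [A] + [C]` for short exact sequences `0 → A → B → C → 0` of coherent
sheaves. -/
def exactRelations (X : Scheme.{0}) : Set (FreeAbelianGroup (Coh X)) :=
  {x | ∃ (A B C : Coh X) (f : A.1 ⟶ B.1) (g : B.1 ⟶ C.1) (w : f ≫ g = 0),
    (ShortComplex.mk f g w).ShortExact ∧
      x = FreeAbelianGroup.of B - FreeAbelianGroup.of A - FreeAbelianGroup.of C}

/-- The Euler form `χ(G, M) = ∑ᵢ (-1)ⁱ dim Extⁱ(G, M)` of a smooth surface, extended additively to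
formal sums of coherent sheaves. -/
def eulerForm (X : Scheme.{0}) [X.Over SpecC] (G : Coh X) : FreeAbelianGroup (Coh X) →+ ℤ :=
  FreeAbelianGroup.lift fun M =>
    ∑ i ∈ Finset.range 3, (-1 : ℤ) ^ i * (Module.finrank ℂ (Ext G.1 M.1 i) : ℤ)

/-- The numerical Grothendieck group of a smooth projective surface: the Grothendieck group of
coherent sheaves modulo the radical of the Euler form. -/
abbrev NumK (X : Scheme.{0}) [X.Over SpecC] : Type 1 :=
  FreeAbelianGroup (Coh X) ⧸
    (AddSubgroup.closure (exactRelations X) ⊔ ⨅ G : Coh X, (eulerForm X G).ker)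

/-- The class of a coherent sheaf in the numerical Grothendieck group. -/
def numClass {X : Scheme.{0}} [X.Over SpecC] (M : Coh X) : NumK X :=
  QuotientAddGroup.mk (FreeAbelianGroup.of M)

/-- The Chern classes of a coherent sheaf `M` of rank `r` on a K3 surface, recorded by the class
`[M] - r[𝒪_X]` in the numerical Grothendieck group. By the Riemann-Roch theorem, and because
`c₁` is determined by its intersection numbers with line bundles, two coherent sheaves of rank `r`
have the same `chern` exactly if they have the same `c₁` and the same `c₂`. Moreover, as
`[𝒪_X]` has trivial Chern classes, for sheaves of different ranks too equality of `chern` means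
equality of `c₁` and of `c₂`. -/
def chern {X : Scheme.{0}} [X.Over SpecC] (M : Coh X) (r : ℕ) : NumK X :=
  numClass M - r • numClass (structureCoh X)

/-- The set of isomorphism classes of sheaves of modules. -/
abbrev IsoClass (X : Scheme.{0}) : Type 1 := Quotient (isIsomorphicSetoid X.Modules)

/-- The points of the moduli space `Spl(r; c₁, c₂)`: isomorphism classes of simple coherent sheaves
of rank `r` with Chern classes `c = (c₁, c₂)`. -/
def Spl (X : Scheme.{0}) [X.Over SpecC] (r : ℕ) (c : NumK X) : Set (IsoClass X) :=
  {ξ | ∃ M : Coh X, IsSimple M.1 ∧ HasRank M.1 r ∧ chern M r = c ∧ Quotient.mk _ M.1 = ξ}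

/-! ## Extension bundles -/

/-- The sheaf `V ⊗ 𝒪_X` for a finite-dimensional vector space `V`, by means of a basis of `V`. It is
characterized by `Hom(V ⊗ 𝒪_X, M) = Hom_ℂ(V, H⁰(M))`: see `tensorVec_desc` and
`tensor_hom_ext`. -/
def tensorO (X : Scheme.{0}) (V : Type*) [AddCommGroup V] [Module ℂ V] [FiniteDimensional ℂ V] :
    X.Modules :=
  trivialBundle X (Module.finrank ℂ V)

/-- The section `x ⊗ 1` of `V ⊗ 𝒪_X`. -/
def tensorVec {X : Scheme.{0}} [X.Over SpecC] {V : Type*} [AddCommGroup V] [Module ℂ V]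
    [FiniteDimensional ℂ V] : V →ₗ[ℂ] H0 (tensorO X V) :=
  (Module.finBasis ℂ V).constr ℂ fun i : Fin (Module.finrank ℂ V) =>
    Sigma.ι (fun _ : Fin (Module.finrank ℂ V) => structureSheaf X) i

lemma tensorVec_basis {X : Scheme.{0}} [X.Over SpecC] {V : Type*} [AddCommGroup V] [Module ℂ V]
    [FiniteDimensional ℂ V] (i : Fin (Module.finrank ℂ V)) :
    tensorVec (X := X) (Module.finBasis ℂ V i) =
      Sigma.ι (fun _ : Fin (Module.finrank ℂ V) => structureSheaf X) i :=
  Module.Basis.constr_basis _ _ _ _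

/-- The morphism `V ⊗ 𝒪_X ⟶ M` induced by a linear map `V → H⁰(M)`. -/
def tensorDesc {X : Scheme.{0}} [X.Over SpecC] {V : Type*} [AddCommGroup V] [Module ℂ V]
    [FiniteDimensional ℂ V] {M : X.Modules} (φ : V →ₗ[ℂ] H0 M) : tensorO X V ⟶ M :=
  Sigma.desc fun i => φ (Module.finBasis ℂ V i)

lemma tensorVec_desc {X : Scheme.{0}} [X.Over SpecC] {V : Type*} [AddCommGroup V] [Module ℂ V]
    [FiniteDimensional ℂ V] {M : X.Modules} (φ : V →ₗ[ℂ] H0 M) (x : V) :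
    tensorVec x ≫ tensorDesc φ = φ x := by
  have h : (Linear.rightComp ℂ (structureSheaf X) (tensorDesc φ)).comp tensorVec = φ := by
    refine (Module.finBasis ℂ V).ext fun i => ?_
    rw [LinearMap.comp_apply, tensorVec_basis]
    exact Sigma.ι_desc (fun j => φ (Module.finBasis ℂ V j)) i
  exact LinearMap.congr_fun h x

lemma tensor_hom_ext {X : Scheme.{0}} [X.Over SpecC] {V : Type*} [AddCommGroup V] [Module ℂ V]
    [FiniteDimensional ℂ V] {M : X.Modules} {f g : tensorO X V ⟶ M}
    (h : ∀ x : V, tensorVec x ≫ f = tensorVec x ≫ g) : f = g := by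
  refine Sigma.hom_ext _ _ fun i => ?_
  have := h (Module.finBasis ℂ V i)
  rwa [tensorVec_basis] at this

/-- The contraction `V ⊗ 𝒪_X ⟶ 𝒪_X` with a linear form on `V`. -/
def contract {X : Scheme.{0}} [X.Over SpecC] {V : Type*} [AddCommGroup V] [Module ℂ V]
    [FiniteDimensional ℂ V] (ξ : Module.Dual ℂ V) : tensorO X V ⟶ structureSheaf X :=
  tensorDesc (ξ.smulRight (𝟙 (structureSheaf X)))

/-- The evaluation map `H⁰(M) ⊗ 𝒪_X ⟶ M`. -/
def evaluation {X : Scheme.{0}} [X.Over SpecC] (M : X.Modules) [FiniteDimensional ℂ (H0 M)] :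
    tensorO X (H0 M) ⟶ M :=
  tensorDesc LinearMap.id

/-- For a vector bundle `F` this is `H¹(X, F^*)`, in the form `Ext¹(F, 𝒪_X)`. -/
abbrev H1Dual {X : Scheme.{0}} (F : X.Modules) : Type 1 := Ext F (structureSheaf X) 1

/-- Let `V^* ⊂ H¹(F^*) = Ext¹(F, 𝒪_X)` be a finite-dimensional subspace and `V` its dual space. An
extension bundle associated to `(F, V)` is (the middle term of) an extension
`0 → V ⊗ 𝒪_X → E → F → 0` whose class `e ∈ Ext¹(F, V ⊗ 𝒪_X) = Hom(V^*, Ext¹(F, 𝒪_X))` is the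
inclusion of `V^*`: for every `ξ ∈ V^*` the contraction of `e` with `ξ` is `ξ`. -/
structure ExtensionBundle {X : Scheme.{0}} [X.Over SpecC] (F : X.Modules)
    (Vstar : Submodule ℂ (H1Dual F)) [FiniteDimensional ℂ Vstar] where
  E : X.Modules
  i : tensorO X (Module.Dual ℂ Vstar) ⟶ E
  p : E ⟶ F
  zero : i ≫ p = 0
  exact : (ShortComplex.mk i p zero).ShortExact
  class_eq : ∀ ξ : Vstar,
    exact.extClass.comp (Ext.mk₀ (contract (Module.Dual.eval ℂ Vstar ξ))) (add_zero 1) = ξ.1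

/-- `F` belongs to `U_e(r; c₁, c₂)`: it is a simple vector bundle of rank `r` with Chern classes
`c = (c₁, c₂)`, and `H⁰(F) = 0` and `H⁰(F^*) = Hom(F, 𝒪_X) = 0`. -/
structure MemUe {X : Scheme.{0}} [X.Over SpecC] (r : ℕ) (c : NumK X) (F : Coh X) : Prop where
  simple : IsSimple F.1
  bundle : IsVectorBundle F.1 r
  chern_eq : chern F r = c
  h0 : Subsingleton (H0 F.1)
  h0_dual : Subsingleton (F.1 ⟶ structureSheaf X)

/-- A pair `(F, V)` with `F` in `U_e(r; c₁, c₂)` and `V^* ⊂ H¹(F^*)` a subspace of dimension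
`v`. -/
structure ExtPair (X : Scheme.{0}) [X.Over SpecC] (r v : ℕ) (c : NumK X) where
  F : Coh X
  mem : MemUe r c F
  Vstar : Submodule ℂ (H1Dual F.1)
  finite : FiniteDimensional ℂ Vstar
  dim : Module.finrank ℂ Vstar = v

attribute [instance] ExtPair.finite

/-- Two pairs define the same point if there is an isomorphism `φ : F ≅ F'` for which `φ^*` carries
`V'^*` to `V^*`. -/
instance extPairSetoid (X : Scheme.{0}) [X.Over SpecC] (r v : ℕ) (c : NumK X) :
    Setoid (ExtPair X r v c) where
  r D D' := ∃ φ : D.F.1 ≅ D'.F.1, ∀ ξ : H1Dual D'.F.1,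
    ξ ∈ D'.Vstar ↔ (Ext.mk₀ φ.hom).comp ξ (zero_add 1) ∈ D.Vstar
  iseqv :=
    { refl := fun D => ⟨Iso.refl _, fun ξ => by simp⟩
      symm := by
        rintro D D' ⟨φ, h⟩
        refine ⟨φ.symm, fun ξ => ?_⟩
        rw [h]
        simp
      trans := by
        rintro D D' D'' ⟨φ, h⟩ ⟨ψ, k⟩
        refine ⟨φ ≪≫ ψ, fun ξ => ?_⟩
        rw [k, h]
        simp }

/-- The points of the moduli space `𝒫_{U_e}`. -/
abbrev PUe (X : Scheme.{0}) [X.Over SpecC] (r v : ℕ) (c : NumK X) : Type 1 :=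
  Quotient (extPairSetoid X r v c)

end K3Ext

end

/-!
Let `e ∈ Ext¹(F, V ⊗ 𝒪_X)` be the tensor that corresponds to the inclusion of `V^*` in
`Ext¹(F, 𝒪_X)`. Every class in `Ext¹` of an abelian category is the class of a short exact sequence
(`CategoryTheory.Abelian.Ext.exists_extClass_eq`), so that extension bundles `E` exist.

The rest depends on `H⁰(X, 𝒪_X) = ℂ` (`K3Ext.scalars_bijective`), which holds because `X` is
proper, reduced and connected: `H⁰(X, 𝒪_X)` is an integral reduced `ℂ`-algebra without nontrivial
idempotents. Hence morphisms between the sheaves `V ⊗ 𝒪_X` are linear maps, and `i` induces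
`V ≅ H⁰(E)`, since `H⁰(F) = 0`; in terms of this isomorphism `i` is the evaluation map of `E`. So
an isomorphism `E ≅ E'` preserves the subsheaves `V ⊗ 𝒪_X` and `V' ⊗ 𝒪_X`. It induces
`φ : F ≅ F'`, and by naturality of extension classes `φ^*` carries `V'^*` to `V^*`. This is the
injectivity of `β` (`K3Ext.ExtensionBundle.exists_iso_quotient`). Conversely, an isomorphism of
pairs is compatible with the two extension classes, and so it extends to the middle terms
(`K3Ext.ExtensionBundle.nonempty_iso`).

Simplicity of `E` (`K3Ext.ExtensionBundle.isSimple`) is a diagram chase: an endomorphism of `E`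
induces a scalar on `F`, and what remains after subtracting this scalar vanishes because
`Hom(V ⊗ 𝒪_X, 𝒪_X) → Ext¹(F, 𝒪_X)` is injective and `Hom(F, 𝒪_X) = 0`. Epimorphisms of sheaves of
modules are locally surjective, so that the extension splits wherever `F` is trivial and the
basis sections of `F` lift; therefore `E` is a vector bundle of rank `r + v`
(`K3Ext.isVectorBundle_of_shortExact`). Its Chern classes are those of `F`, because the class of
`V ⊗ 𝒪_X` in the Grothendieck group is `v [𝒪_X]`.
-/

noncomputable section

/-! ### Extensions in abelian categories -/

namespace CategoryTheory.Abelian.Ext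

universe w v u

variable {C : Type u} [Category.{v} C] [Abelian C]

open HomologicalComplex in
/-- A quasi-isomorphism from an object placed in degree `n` to a complex that vanishes below degree
`n` is a monomorphism in degree `n`, because there the cycles of the target are its homology. -/
lemma mono_singleObjXSelf_inv_comp {Y : C} {L : CochainComplex C ℤ} {n : ℤ} [L.IsStrictlyGE n]
    (ι : (single C (ComplexShape.up ℤ) n).obj Y ⟶ L) [QuasiIsoAt ι n] :
    Mono ((singleObjXSelf (ComplexShape.up ℤ) n Y).inv ≫ ι.f n) := by
  let e := L.pOpcyclesIso (n - 1) n (by simp)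
    ((L.isZero_of_isStrictlyGE n (n - 1) (by simp)).eq_of_src _ _)
  have : (singleObjXSelf (ComplexShape.up ℤ) n Y).inv ≫ ι.f n =
      (singleObjHomologySelfIso _ _ _).inv ≫ homologyMap ι n ≫ L.homologyι n ≫ e.inv := by
    rw [← cancel_mono e.hom]
    dsimp [e]
    simp only [Category.assoc, pOpcyclesIso_inv_hom_id, pOpcyclesIso_hom,
      Category.comp_id, homologyι_naturality, singleObjHomologySelfIso_inv_homologyι_assoc]
    rw [singleObjOpcyclesSelfIso_hom, Category.assoc, p_opcyclesMap]
  rw [this]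
  infer_instance

open HomologicalComplex in
lemma exists_comp_eq_single_map {Y : C} {L : CochainComplex C ℤ} {n : ℤ} [L.IsStrictlyGE n]
    (ι : (single C (ComplexShape.up ℤ) n).obj Y ⟶ L) :
    ∃ π : L ⟶ (single C (ComplexShape.up ℤ) n).obj (L.X n),
      ι ≫ π = (single C (ComplexShape.up ℤ) n).map
        ((singleObjXSelf (ComplexShape.up ℤ) n Y).inv ≫ ι.f n) := by
  refine ⟨mkHomToSingle (𝟙 _) ?_, ?_⟩
  · rintro k hk
    exact (L.isZero_of_isStrictlyGE n k (by simp at hk; lia)).eq_of_src _ _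
  · apply HomologicalComplex.to_single_hom_ext
    rw [comp_f, mkHomToSingle_f, single_map_f_self]
    simp

open CategoryTheory.DerivedCategory _root_.DerivedCategory HomologicalComplex in
/-- A class in `Ext¹(X, Y)` is killed by a monomorphism out of `Y`; no injective objects are needed.
In the derived category the class is a morphism `X ⟶ Y[1]`, that is, a left fraction
`X ⟶ L ⟵ Y[1]` whose second arrow `ι` is a quasi-isomorphism, and `L` may be taken to vanish in
degrees `< -1`. Then `ι` is a monomorphism `j` in degree `-1`, and projecting `L` to its component
of degree `-1` extends `j[1]` along `ι`. The composite `X ⟶ L ⟶ L⁻¹[1]` is zero because `X` sits in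
degree `0`. -/
lemma exists_mono_comp_mk₀_eq_zero [HasExt.{w} C] {X Y : C} (x : Ext X Y 1) :
    ∃ (I : C) (j : Y ⟶ I), Mono j ∧ x.comp (mk₀ j) (add_zero 1) = 0 := by
  let := HasDerivedCategory.standard C
  let e := ((DerivedCategory.singleFunctors C).shiftIso (1 : ℤ) (-1) 0 (by lia))
  let K := (CochainComplex.singleFunctor C 0).obj X
  let S := (CochainComplex.singleFunctor C (-1)).obj Y
  let φ : Q.obj K ⟶ Q.obj S := x.hom ≫ e.hom.app Y
  obtain ⟨L, _, g, ι, hι, hφ⟩ := left_fac_of_isStrictlyGE φ (-1)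
  let j : Y ⟶ L.X (-1) := (singleObjXSelf (ComplexShape.up ℤ) (-1) Y).inv ≫ ι.f (-1)
  have hmono : Mono j := by
    rw [isIso_Q_map_iff_quasiIso] at hι
    have hq : QuasiIsoAt ι (-1) := inferInstance
    exact @mono_singleObjXSelf_inv_comp _ _ _ _ _ _ _ ι hq
  obtain ⟨π, hπ⟩ : ∃ π : L ⟶ (CochainComplex.singleFunctor C (-1)).obj (L.X (-1)),
      ι ≫ π = (CochainComplex.singleFunctor C (-1)).map j := exists_comp_eq_single_map ι
  have hg : g ≫ π = 0 := by
    apply HomologicalComplex.to_single_hom_ext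
    apply (isZero_single_obj_X (ComplexShape.up ℤ) 0 X (-1) (by simp)).eq_of_src
  refine ⟨_, j, hmono, ?_⟩
  ext
  have h : φ ≫ Q.map ((CochainComplex.singleFunctor C (-1)).map j) = 0 := by
    rw [hφ, ← hπ, Q.map_comp, Category.assoc, IsIso.inv_hom_id_assoc, ← Q.map_comp, hg, Q.map_zero]
  have hn := e.hom.naturality j
  rw [comp_hom, mk₀_hom, ShiftedHom.comp_mk₀, zero_hom, ← cancel_mono (e.hom.app _)]
  rw [Limits.zero_comp, Category.assoc]
  refine (congrArg (x.hom ≫ ·) hn).trans ?_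
  rw [← Category.assoc]
  exact h

/-- The pullback of a short exact sequence along `g`; its class is the product of `g` with the
class of the sequence. -/
lemma _root_.CategoryTheory.ShortComplex.ShortExact.exists_extClass_eq_comp [HasExt.{w} C]
    {S : ShortComplex C} (hS : S.ShortExact) {X : C} (g : X ⟶ S.X₃) :
    ∃ (E : C) (i : S.X₁ ⟶ E) (p : E ⟶ X) (w : i ≫ p = 0)
      (h : (ShortComplex.mk i p w).ShortExact),
      h.extClass = (mk₀ g).comp hS.extClass (zero_add 1) := by
  have := hS.epi_g
  have := hS.mono_f
  obtain ⟨k, hk₁, hk₂⟩ : ∃ k : S.X₁ ⟶ pullback S.g g,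
      k ≫ pullback.fst S.g g = S.f ∧ k ≫ pullback.snd S.g g = 0 :=
    ⟨pullback.lift S.f 0 (by rw [S.zero, Limits.zero_comp]), pullback.lift_fst _ _ _,
      pullback.lift_snd _ _ _⟩
  have h : (ShortComplex.mk k (pullback.snd S.g g) hk₂).ShortExact :=
    { exact := by
        rw [ShortComplex.exact_iff_exact_up_to_refinements]
        intro A x hx
        have hx : x ≫ pullback.snd S.g g = 0 := hx
        have h1 : (x ≫ pullback.fst S.g g) ≫ S.g = 0 := by
          rw [Category.assoc, pullback.condition, reassoc_of% hx, Limits.zero_comp]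
        refine ⟨A, 𝟙 _, inferInstance, hS.exact.lift _ h1, ?_⟩
        apply pullback.hom_ext
        · simp [hk₁]
        · simp [hk₂, hx]
      mono_f := mono_of_mono_fac hk₁
      epi_g := inferInstanceAs (Epi (pullback.snd S.g g)) }
  refine ⟨_, _, _, hk₂, h, ?_⟩
  let f : ShortComplex.mk _ _ hk₂ ⟶ S :=
    { τ₁ := 𝟙 _
      τ₂ := pullback.fst S.g g
      τ₃ := g
      comm₁₂ := by simp [hk₁]
      comm₂₃ := pullback.condition }
  simpa [f] using h.extClass_naturality hS f

/-- Every class in `Ext¹` is the class of a short exact sequence: it dies in `Ext¹(X, I)` for a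
monomorphism `Y ⟶ I`, so that it comes from a morphism `X ⟶ I/Y`, along which
`0 → Y → I → I/Y → 0` can be pulled back. -/
lemma exists_extClass_eq [HasExt.{w} C] {X Y : C} (x : Ext X Y 1) :
    ∃ (E : C) (i : Y ⟶ E) (p : E ⟶ X) (w : i ≫ p = 0)
      (h : (ShortComplex.mk i p w).ShortExact), h.extClass = x := by
  obtain ⟨I, j, _, hj⟩ := exists_mono_comp_mk₀_eq_zero x
  have hS : (ShortComplex.mk _ _ (cokernel.condition j)).ShortExact :=
    { exact := ShortComplex.exact_of_g_is_cokernel _ (cokernelIsCokernel j) }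
  obtain ⟨y, rfl⟩ := covariant_sequence_exact₁ X hS x hj (zero_add 1)
  obtain ⟨g, rfl⟩ := (mk₀_bijective _ _).2 y
  exact hS.exists_extClass_eq_comp g

end CategoryTheory.Abelian.Ext

namespace CategoryTheory.ShortComplex.ShortExact

universe w v u
variable {C : Type u} [Category.{v} C] [Abelian C]

lemma exists_desc {S : ShortComplex C} (h : S.ShortExact) {Z : C} (k : S.X₂ ⟶ Z)
    (hk : S.f ≫ k = 0) : ∃ l : S.X₃ ⟶ Z, S.g ≫ l = k :=
  have := h.epi_g
  ⟨h.exact.desc k hk, h.exact.g_desc k hk⟩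

lemma exists_lift {S : ShortComplex C} (h : S.ShortExact) {Z : C} (k : Z ⟶ S.X₂)
    (hk : k ≫ S.g = 0) : ∃ l : Z ⟶ S.X₁, l ≫ S.f = k :=
  have := h.mono_f
  ⟨h.exact.lift k hk, h.exact.lift_f k hk⟩

/-- Morphisms `f` and `g` of the outer terms extend to a morphism of short exact sequences if they
are compatible with the extension classes. First a morphism `k` of the middle terms over `g` is
found; it induces some `f₀` on the left, and as `f - f₀` extends to the middle term, `k` can be
corrected. -/
lemma exists_hom_of_extClass_comp_eq [HasExt.{w} C] {S S' : ShortComplex C} (h : S.ShortExact)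
    (h' : S'.ShortExact) (f : S.X₁ ⟶ S'.X₁) (g : S.X₃ ⟶ S'.X₃)
    (hfg : h.extClass.comp (Ext.mk₀ f) (add_zero 1) =
      (Ext.mk₀ g).comp h'.extClass (zero_add 1)) :
    ∃ φ : S ⟶ S', φ.τ₁ = f ∧ φ.τ₃ = g := by
  obtain ⟨y, hy⟩ := Ext.covariant_sequence_exact₃ S.X₂ h' (Ext.mk₀ (S.g ≫ g)) (zero_add 1) (by
    rw [← Ext.mk₀_comp_mk₀_assoc, ← hfg, h.comp_extClass_assoc])
  obtain ⟨k, rfl⟩ := (Ext.mk₀_bijective _ _).2 y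
  rw [Ext.mk₀_comp_mk₀] at hy
  have hk : k ≫ S'.g = S.g ≫ g := (Ext.mk₀_bijective _ _).1 hy
  obtain ⟨f₀, hf₀⟩ := h'.exists_lift (S.f ≫ k) (by
    rw [Category.assoc, hk, S.zero_assoc, Limits.zero_comp])
  -- `f₀` has the same product with the class of `S` as `f`, so `f - f₀` extends to `S.X₂`.
  let φ₀ : S ⟶ S' := { τ₁ := f₀, τ₂ := k, τ₃ := g, comm₁₂ := hf₀, comm₂₃ := hk }
  have hφ₀ := h.extClass_naturality h' φ₀
  obtain ⟨y, hy⟩ := Ext.contravariant_sequence_exact₁ h S'.X₁ (Ext.mk₀ (f - f₀)) (add_zero 1) (by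
    rw [sub_eq_add_neg, Ext.mk₀_add, Ext.comp_add, Ext.mk₀_neg, Ext.comp_neg, hfg, ← hφ₀]
    simp [φ₀])
  obtain ⟨l, rfl⟩ := (Ext.mk₀_bijective _ _).2 y
  rw [Ext.mk₀_comp_mk₀] at hy
  have hl : S.f ≫ l = f - f₀ := (Ext.mk₀_bijective _ _).1 hy
  exact ⟨{ τ₁ := f, τ₂ := k + l ≫ S'.f, τ₃ := g
           comm₁₂ := by rw [Preadditive.comp_add, reassoc_of% hl, Preadditive.sub_comp, hf₀]; abel
           comm₂₃ := by rw [Preadditive.add_comp, Category.assoc, S'.zero, comp_zero, add_zero, hk] },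
    rfl, rfl⟩

end CategoryTheory.ShortComplex.ShortExact

/-! ### Global functions on a K3 surface -/

open TensorProduct in
/-- An étale algebra `A` over a domain `P` is flat, so that it embeds into its base change to the
fraction field of `P`, and étale algebras over fields are reduced. -/
lemma Algebra.Etale.isReduced_of_isDomain (P A : Type*) [CommRing P] [IsDomain P] [CommRing A]
    [Algebra P A] [Algebra.Etale P A] : IsReduced A := by
  have : IsReduced (FractionRing P ⊗[P] A) :=
    Algebra.FormallyUnramified.isReduced_of_field (FractionRing P) _
  exact isReduced_of_injective (Algebra.TensorProduct.includeRight : A →ₐ[P] FractionRing P ⊗[P] A)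
    (Algebra.TensorProduct.includeRight_injective (IsFractionRing.injective P (FractionRing P)))

lemma RingHom.IsStandardSmooth.isReduced {R A : Type*} [CommRing R] [IsDomain R] [CommRing A]
    {f : R →+* A} (hf : f.IsStandardSmooth) : IsReduced A := by
  obtain ⟨n, g, -, hg⟩ := hf.exists_etale_mvPolynomial
  algebraize [g]
  exact Algebra.Etale.isReduced_of_isDomain (MvPolynomial (Fin n) R) A

lemma AlgebraicGeometry.Smooth.isReduced {X Y : Scheme.{0}} (f : X ⟶ Y) [Smooth f] [IsIntegral Y] :
    IsReduced X := by
  have (x : X) : _root_.IsReduced (X.presheaf.stalk x) := by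
    obtain ⟨U, hU, V, hV, hx, e, hf⟩ := Smooth.exists_isStandardSmooth f x
    have : Nonempty U := ⟨⟨_, e hx⟩⟩
    have hred : _root_.IsReduced Γ(X, V) := hf.isReduced
    let := X.presheaf.algebra_section_stalk ⟨x, hx⟩
    have := hV.isLocalization_stalk ⟨x, hx⟩
    exact isReduced_localizationPreserves (hV.primeIdealOf ⟨x, hx⟩).asIdeal.primeCompl
      (X.presheaf.stalk x) hred
  exact isReduced_of_isReduced_stalk X

lemma AlgebraicGeometry.Scheme.eq_zero_or_one_of_mul_self {X : Scheme.{0}} [IsReduced X]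
    [ConnectedSpace X] {e : Γ(X, ⊤)} (he : e * e = e) : e = 0 ∨ e = 1 := by
  have h₁ : X.basicOpen e ⊓ X.basicOpen (1 - e) = ⊥ := by
    rw [← Scheme.basicOpen_mul, mul_sub, mul_one, he, sub_self, Scheme.basicOpen_zero]
  have h₂ : X.basicOpen e ⊔ X.basicOpen (1 - e) = ⊤ := by
    rw [eq_top_iff]
    have := X.basicOpen_add_le e (1 - e)
    rwa [add_sub_cancel, Scheme.basicOpen_one] at this
  have hc : IsClopen (X.basicOpen e : Set X) := by
    refine ⟨⟨?_⟩, (X.basicOpen e).2⟩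
    convert (X.basicOpen (1 - e)).2 using 1
    refine IsCompl.compl_eq ⟨?_, ?_⟩
    · rw [Set.disjoint_iff_inter_eq_empty]
      exact congrArg (fun U : X.Opens => (U : Set X)) h₁
    · rw [codisjoint_iff]
      exact congrArg (fun U : X.Opens => (U : Set X)) h₂
  rcases isClopen_iff.1 hc with h | h
  · left
    rw [← basicOpen_eq_bot_iff]
    exact TopologicalSpace.Opens.ext h
  · right
    have h' : X.basicOpen e = ⊤ := TopologicalSpace.Opens.ext h
    rw [h', top_inf_eq, basicOpen_eq_bot_iff] at h₁
    exact (sub_eq_zero.1 h₁).symm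

open Polynomial in
/-- An algebra over an algebraically closed field `K` is `K` if it is integral, reduced and has no
idempotents besides `0` and `1`: factor the minimal polynomial of an element as `(X - c)ᵏ * q` with
coprime factors; the idempotent that belongs to this factorization shows that `q` is constant. -/
lemma algebraMap_surjective_of_isIntegral_of_isReduced {K A : Type*} [Field K] [IsAlgClosed K]
    [CommRing A] [Nontrivial A] [Algebra K A] [Algebra.IsIntegral K A] [IsReduced A]
    (hA : ∀ e : A, e * e = e → e = 0 ∨ e = 1) : Function.Surjective (algebraMap K A) := by
  intro f
  have hf := Algebra.IsIntegral.isIntegral (R := K) f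
  obtain ⟨c, hc⟩ := IsAlgClosed.exists_root _ (minpoly.degree_pos hf).ne'
  obtain ⟨q, hq, hdvd⟩ := (minpoly K f).exists_eq_pow_rootMultiplicity_mul_and_not_dvd
    (minpoly.ne_zero hf) c
  set k := (minpoly K f).rootMultiplicity c
  have hk : k ≠ 0 := (rootMultiplicity_pos (minpoly.ne_zero hf)).2 hc |>.ne'
  have hcop : IsCoprime ((X - C c) ^ k) q :=
    ((irreducible_X_sub_C c).coprime_iff_not_dvd.2 hdvd).pow_left
  obtain ⟨a, b, hab⟩ := hcop
  have hz : aeval f ((X - C c) ^ k * q) = 0 := by rw [← hq, minpoly.aeval]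
  have he : aeval f (b * q) * aeval f (b * q) = aeval f (b * q) := by
    have h1 : b * q * (b * q) = b * q - a * b * ((X - C c) ^ k * q) := by
      linear_combination (b * q) * hab
    rw [← map_mul, h1, map_sub, map_mul (aeval f) (a * b), hz, mul_zero, sub_zero]
  rcases hA _ he with h | h
  · exfalso
    have h1 : (X - C c) ^ k ∣ b * q := (Dvd.intro _ hq.symm).trans (minpoly.dvd K f h)
    have h2 : (X - C c) ^ k ∣ 1 := hab ▸ dvd_add (dvd_mul_left _ _) h1
    exact (irreducible_X_sub_C c).not_isUnit ((isUnit_pow_iff hk).1 (isUnit_of_dvd_one h2))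
  · have h0 : aeval f (a * (X - C c) ^ k) = 0 := by
      have := congrArg (aeval f) hab
      rwa [map_add, h, map_one, add_eq_right] at this
    have h1 : q ∣ a * (X - C c) ^ k := (Dvd.intro_left _ hq.symm).trans (minpoly.dvd K f h0)
    have h2 : q ∣ 1 := hab ▸ dvd_add h1 (dvd_mul_left _ _)
    have h3 : IsUnit (aeval f q) := (isUnit_of_dvd_one h2).map _
    rw [map_mul, h3.mul_left_eq_zero, map_pow] at hz
    have h4 := eq_zero_of_pow_eq_zero hz
    rw [map_sub, aeval_X, aeval_C, sub_eq_zero] at h4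
    exact ⟨c, h4.symm⟩

namespace K3Ext

attribute [local instance] MvPolynomial.gradedAlgebra

instance (n : ℕ) : IsProper (projSpaceToSpec n) := by
  -- The polynomials of degree `0` are the constants, so that `ℙⁿ` lies over `Spec ℂ`.
  have hb : Function.Bijective
      (algebraMap ℂ (MvPolynomial.homogeneousSubmodule (Fin (n + 1)) ℂ 0)) := by
    refine ⟨fun a b hab => MvPolynomial.C_injective (Fin (n + 1)) ℂ (congrArg Subtype.val hab),
      fun x => ?_⟩
    obtain ⟨c, hc⟩ := Submodule.mem_one.1
      ((SetLike.ext_iff.1 (MvPolynomial.homogeneousSubmodule_zero _) x.1).1 x.2)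
    exact ⟨c, Subtype.ext hc⟩
  have : IsIso (CommRingCat.ofHom
      (algebraMap ℂ (MvPolynomial.homogeneousSubmodule (Fin (n + 1)) ℂ 0))) :=
    (ConcreteCategory.isIso_iff_bijective _).2 hb
  have : IsScalarTower ℂ (MvPolynomial.homogeneousSubmodule (Fin (n + 1)) ℂ 0)
      (MvPolynomial (Fin (n + 1)) ℂ) :=
    ⟨fun c x y => smul_mul_assoc c x.1 y⟩
  have : Algebra.FiniteType (MvPolynomial.homogeneousSubmodule (Fin (n + 1)) ℂ 0)
      (MvPolynomial (Fin (n + 1)) ℂ) := Algebra.FiniteType.of_restrictScalars_finiteType ℂ _ _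
  unfold projSpaceToSpec
  infer_instance

lemma isProper_of_isK3 (X : Scheme.{0}) [X.Over SpecC] [IsK3 X] : IsProper (X ↘ SpecC) := by
  obtain ⟨n, j, _, hj⟩ := IsK3.projective (X := X)
  rw [← hj]
  infer_instance

/-- `H⁰(X, 𝒪_X) = ℂ`, as `X` is proper, reduced (being smooth) and connected. -/
lemma scalars_bijective (X : Scheme.{0}) [X.Over SpecC] [IsK3 X] :
    Function.Bijective (scalars X) := by
  have := IsK3.connected (X := X)
  have : Nonempty (⊤ : X.Opens) := ⟨⟨Nonempty.some inferInstance, trivial⟩⟩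
  have : Nontrivial Γ(X, ⊤) := Scheme.component_nontrivial X ⊤
  refine ⟨(scalars X).injective, ?_⟩
  have := isProper_of_isK3 X
  have := IsK3.smooth (X := X)
  have := SmoothOfRelativeDimension.smooth 2 (X ↘ SpecC)
  have := AlgebraicGeometry.Smooth.isReduced (X ↘ SpecC)
  have h : (scalars X).IsIntegral := by
    refine RingHom.IsIntegral.trans _ _ ?_ (isIntegral_appTop_of_universallyClosed (X ↘ SpecC))
    exact RingHom.isIntegral_of_surjective _
      (Scheme.ΓSpecIso (CommRingCat.of ℂ)).commRingCatIsoToRingEquiv.symm.surjective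
  algebraize [scalars X]
  exact algebraMap_surjective_of_isIntegral_of_isReduced (K := ℂ) (A := Γ(X, ⊤)) fun e he =>
    Scheme.eq_zero_or_one_of_mul_self he

end K3Ext

/-! ### The sheaves `V ⊗ 𝒪_X` -/

namespace K3Ext

section tensor

variable {X : Scheme.{0}} [X.Over SpecC] {V : Type*} [AddCommGroup V] [Module ℂ V]
  [FiniteDimensional ℂ V]

lemma globalSectionsEquiv_smul_id (c : ℂ) :
    globalSectionsEquiv (structureSheaf X) (c • 𝟙 (structureSheaf X)) = scalars X c := by
  change (globalSMul (structureSheaf X) (scalars X c)).app ⊤ (1 : Γ(X, ⊤)) = _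
  refine (globalSMul_app _ _ _ _).trans ?_
  change X.presheaf.map (𝟙 _) (scalars X c) * (1 : Γ(X, ⊤)) = _
  rw [mul_one]
  simp

lemma tensorVec_contract (x : V) (ξ : Module.Dual ℂ V) :
    tensorVec (X := X) x ≫ contract ξ = ξ x • 𝟙 (structureSheaf X) := by
  rw [contract, tensorVec_desc]
  rfl

/-- The identity of `V ⊗ 𝒪_X` is the sum of the projections to the lines spanned by a basis. -/
lemma sum_contract_tensorVec {ι : Type*} [Fintype ι] [DecidableEq ι] (b : Module.Basis ι ℂ V) :
    ∑ i, contract (X := X) (b.coord i) ≫ tensorVec (b i) = 𝟙 (tensorO X V) := by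
  refine tensor_hom_ext fun x => ?_
  rw [Preadditive.comp_sum, Category.comp_id]
  conv_rhs => rw [← b.sum_repr x, map_sum]
  refine Finset.sum_congr rfl fun i _ => ?_
  rw [← Category.assoc, tensorVec_contract, Linear.smul_comp, Category.id_comp, map_smul]
  rfl

lemma hom_ext_contract {M : X.Modules} {f g : M ⟶ tensorO X V}
    (h : ∀ ξ : Module.Dual ℂ V, f ≫ contract ξ = g ≫ contract ξ) : f = g := by
  classical
  rw [← Category.comp_id f, ← Category.comp_id g,
    ← sum_contract_tensorVec (Module.finBasis ℂ V)]
  simp only [Preadditive.comp_sum, ← Category.assoc, h]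

lemma ext_ext_contract {M : X.Modules} {n : ℕ} {e e' : Ext M (tensorO X V) n}
    (h : ∀ ξ : Module.Dual ℂ V, e.comp (Ext.mk₀ (contract ξ)) (add_zero n) =
      e'.comp (Ext.mk₀ (contract ξ)) (add_zero n)) : e = e' := by
  classical
  rw [← Ext.comp_mk₀_id e, ← Ext.comp_mk₀_id e',
    ← sum_contract_tensorVec (Module.finBasis ℂ V), Ext.mk₀_sum, Ext.comp_sum, Ext.comp_sum]
  refine Finset.sum_congr rfl fun i _ => ?_
  rw [← Ext.mk₀_comp_mk₀, ← Ext.comp_assoc_of_second_deg_zero,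
    ← Ext.comp_assoc_of_second_deg_zero, h]

/-- The surjectivity of `Extⁿ(M, U^* ⊗ 𝒪_X) → Hom(U, Extⁿ(M, 𝒪_X))`, for the inclusion of a
subspace `U`: the class is `∑ᵢ bᵢ ⊗ bᵢ^*` for a basis `bᵢ` of `U`. -/
lemma exists_ext_contract_eq {M : X.Modules} {n : ℕ}
    (U : Submodule ℂ (Ext M (structureSheaf X) n)) [FiniteDimensional ℂ U] :
    ∃ e : Ext M (tensorO X (Module.Dual ℂ U)) n, ∀ ξ : U,
      e.comp (Ext.mk₀ (contract (Module.Dual.eval ℂ U ξ))) (add_zero n) = ξ.1 := by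
  let b := Module.finBasis ℂ U
  refine ⟨∑ i, (b i).1.comp (Ext.mk₀ (tensorVec (X := X) (b.coord i))) (add_zero n), fun ξ => ?_⟩
  rw [Ext.sum_comp]
  conv_rhs => rw [← b.sum_repr ξ, AddSubmonoidClass.coe_finsetSum]
  refine Finset.sum_congr rfl fun i _ => ?_
  rw [Ext.comp_assoc_of_second_deg_zero, Ext.mk₀_comp_mk₀, tensorVec_contract, Ext.mk₀_smul,
    Ext.comp_smul, Ext.comp_mk₀_id]
  rfl

variable [IsK3 X]

lemma smul_id_injective : Function.Injective fun c : ℂ => c • 𝟙 (structureSheaf X) := by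
  intro c d h
  have := congrArg (globalSectionsEquiv (structureSheaf X)) h
  simp only [globalSectionsEquiv_smul_id] at this
  exact (scalars_bijective X).1 this

lemma exists_eq_smul_id (f : structureSheaf X ⟶ structureSheaf X) :
    ∃ c : ℂ, f = c • 𝟙 (structureSheaf X) := by
  obtain ⟨c, hc⟩ := (scalars_bijective X).2 (globalSectionsEquiv (structureSheaf X) f)
  refine ⟨c, (globalSectionsEquiv (structureSheaf X)).injective ?_⟩
  rw [globalSectionsEquiv_smul_id]
  exact hc.symm

variable (X V) in
/-- `V = H⁰(V ⊗ 𝒪_X)`, because `H⁰(𝒪_X) = ℂ`. -/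
lemma tensorVec_bijective : Function.Bijective (tensorVec (X := X) (V := V)) := by
  classical
  constructor
  · rw [injective_iff_map_eq_zero]
    intro x hx
    rw [← Module.forall_dual_apply_eq_zero_iff ℂ]
    intro ξ
    apply smul_id_injective (X := X)
    change ξ x • _ = (0 : ℂ) • _
    rw [← tensorVec_contract, hx, zero_comp, zero_smul]
  · intro f
    let b := Module.finBasis ℂ V
    choose c hc using fun i => exists_eq_smul_id (f ≫ contract (b.coord i))
    refine ⟨∑ i, c i • b i, ?_⟩
    rw [← Category.comp_id f, ← sum_contract_tensorVec b, Preadditive.comp_sum, map_sum]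
    refine Finset.sum_congr rfl fun i _ => ?_
    rw [← Category.assoc, hc, Linear.smul_comp, Category.id_comp, map_smul]

lemma exists_eq_contract (f : tensorO X V ⟶ structureSheaf X) :
    ∃ ξ : Module.Dual ℂ V, f = contract ξ := by
  let b := Module.finBasis ℂ V
  choose c hc using fun x : V => exists_eq_smul_id (tensorVec x ≫ f)
  refine ⟨b.constr ℂ fun i => c (b i), ?_⟩
  refine tensor_hom_ext fun x => ?_
  have h : (Linear.rightComp ℂ (structureSheaf X) f).comp tensorVec =
      (Linear.rightComp ℂ (structureSheaf X) (contract (b.constr ℂ fun i => c (b i)))).comp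
        tensorVec := by
    refine b.ext fun i => ?_
    change tensorVec (b i) ≫ f = tensorVec (b i) ≫ contract _
    rw [tensorVec_contract, hc, Module.Basis.constr_basis]
  exact LinearMap.congr_fun h x

end tensor

/-! ### Extension bundles -/

variable {X : Scheme.{0}} [X.Over SpecC] {F : X.Modules} {Vstar : Submodule ℂ (H1Dual F)}
  [FiniteDimensional ℂ Vstar]

variable (F Vstar) in
lemma nonempty_extensionBundle : Nonempty (ExtensionBundle F Vstar) := by
  obtain ⟨e, he⟩ := exists_ext_contract_eq Vstar
  obtain ⟨E, i, p, w, h, rfl⟩ := Ext.exists_extClass_eq e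
  exact ⟨⟨E, i, p, w, h, he⟩⟩

lemma tensorO_hom_eq_zero {V : Type*} [AddCommGroup V] [Module ℂ V] [FiniteDimensional ℂ V]
    {F : X.Modules} (hF : Subsingleton (H0 F)) (f : tensorO X V ⟶ F) : f = 0 :=
  tensor_hom_ext fun _ => Subsingleton.elim _ _

/-- The isomorphism `V ⊗ 𝒪_X ≅ W ⊗ 𝒪_X` induced by a linear equivalence `V ≃ W`. -/
def tensorIso {V W : Type*} [AddCommGroup V] [Module ℂ V] [FiniteDimensional ℂ V]
    [AddCommGroup W] [Module ℂ W] [FiniteDimensional ℂ W] (e : V ≃ₗ[ℂ] W) :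
    tensorO X V ≅ tensorO X W where
  hom := tensorDesc (tensorVec.comp e.toLinearMap)
  inv := tensorDesc (tensorVec.comp e.symm.toLinearMap)
  hom_inv_id := tensor_hom_ext fun x => by
    rw [← Category.assoc, tensorVec_desc, Category.comp_id]
    simp [tensorVec_desc]
  inv_hom_id := tensor_hom_ext fun x => by
    rw [← Category.assoc, tensorVec_desc, Category.comp_id]
    simp [tensorVec_desc]

namespace ExtensionBundle

variable (T : ExtensionBundle F Vstar)

instance : Mono T.i := T.exact.mono_f

instance : Epi T.p := T.exact.epi_g

/-- The extension bundles of equivalent pairs are isomorphic: pulling back along `φ` identifies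
`V'^*` with `V^*`, hence `V` with `V'`, and this identification is compatible with the two
extension classes. -/
lemma nonempty_iso {F' : X.Modules} {Vstar' : Submodule ℂ (H1Dual F')}
    [FiniteDimensional ℂ Vstar'] (T' : ExtensionBundle F' Vstar') (φ : F ≅ F')
    (hφ : ∀ ξ : H1Dual F', ξ ∈ Vstar' ↔ (Ext.mk₀ φ.hom).comp ξ (zero_add 1) ∈ Vstar) :
    Nonempty (T.E ≅ T'.E) := by
  let a₀ := Ext.precompOfLinear (Ext.mk₀ φ.hom) ℂ (structureSheaf X) (zero_add 1)
  let a : Vstar' →ₗ[ℂ] Vstar := a₀.restrict fun ξ hξ => (hφ ξ).1 hξ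
  have ha : Function.Bijective a := by
    constructor
    · intro ξ η h
      have h : (Ext.mk₀ φ.hom).comp ξ.1 (zero_add 1) = (Ext.mk₀ φ.hom).comp η.1 (zero_add 1) :=
        congrArg Subtype.val h
      have := congrArg (fun ζ => (Ext.mk₀ φ.inv).comp ζ (zero_add 1)) h
      simp only [Ext.mk₀_comp_mk₀_assoc, Iso.inv_hom_id, Ext.mk₀_id_comp] at this
      exact Subtype.ext this
    · intro η
      have h : (Ext.mk₀ φ.hom).comp ((Ext.mk₀ φ.inv).comp η.1 (zero_add 1)) (zero_add 1) = η.1 := by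
        rw [Ext.mk₀_comp_mk₀_assoc, Iso.hom_inv_id, Ext.mk₀_id_comp]
      exact ⟨⟨_, (hφ _).2 (h.symm ▸ η.2)⟩, Subtype.ext h⟩
  let f : tensorO X (Module.Dual ℂ Vstar) ≅ tensorO X (Module.Dual ℂ Vstar') :=
    tensorIso (LinearEquiv.ofBijective a ha).dualMap
  have hf (ξ : Vstar') : f.hom ≫ contract (Module.Dual.eval ℂ Vstar' ξ) =
      contract (Module.Dual.eval ℂ Vstar (a ξ)) := tensor_hom_ext fun x => by
    rw [← Category.assoc, tensorVec_contract]
    change (tensorVec x ≫ tensorDesc _) ≫ _ = _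
    rw [tensorVec_desc]
    exact tensorVec_contract _ _
  have hfg : T.exact.extClass.comp (Ext.mk₀ f.hom) (add_zero 1) =
      (Ext.mk₀ φ.hom).comp T'.exact.extClass (zero_add 1) := by
    refine ext_ext_contract fun ζ => ?_
    obtain ⟨ξ, rfl⟩ := (Module.evalEquiv ℂ Vstar').surjective ζ
    change Ext.comp _ (Ext.mk₀ (contract (Module.Dual.eval ℂ Vstar' ξ))) _ =
      Ext.comp _ (Ext.mk₀ (contract (Module.Dual.eval ℂ Vstar' ξ))) _
    rw [Ext.comp_assoc_of_second_deg_zero, Ext.mk₀_comp_mk₀, hf, T.class_eq,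
      Ext.comp_assoc_of_third_deg_zero, T'.class_eq]
    rfl
  obtain ⟨Φ, h₁, h₃⟩ := T.exact.exists_hom_of_extClass_comp_eq T'.exact f.hom φ.hom hfg
  have : IsIso Φ.τ₁ := h₁ ▸ inferInstanceAs (IsIso f.hom)
  have : IsIso Φ.τ₃ := h₃ ▸ inferInstanceAs (IsIso φ.hom)
  have := ShortComplex.isIso₂_of_shortExact_of_isIso₁₃ Φ T.exact T'.exact
  exact ⟨asIso Φ.τ₂⟩

variable [IsK3 X]

/-- The contraction of `f_*(e)` with `ξ`, where `e` is the class of the extension and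
`f : V ⊗ 𝒪_X ⟶ W ⊗ 𝒪_X`, belongs to `V^*`, and it determines `f ≫ contract ξ`. -/
lemma exists_comp_contract_eq {W : Type*} [AddCommGroup W] [Module ℂ W] [FiniteDimensional ℂ W]
    (f : tensorO X (Module.Dual ℂ Vstar) ⟶ tensorO X W) (ξ : Module.Dual ℂ W) :
    ∃ η : Vstar, f ≫ contract ξ = contract (Module.Dual.eval ℂ Vstar η) ∧
      (T.exact.extClass.comp (Ext.mk₀ f) (add_zero 1)).comp (Ext.mk₀ (contract ξ)) (add_zero 1) =
        η.1 := by
  obtain ⟨ζ, hζ⟩ := exists_eq_contract (f ≫ contract ξ)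
  obtain ⟨η, rfl⟩ := (Module.evalEquiv ℂ Vstar).surjective ζ
  refine ⟨η, hζ, ?_⟩
  rw [Ext.comp_assoc_of_second_deg_zero, Ext.mk₀_comp_mk₀, hζ]
  exact T.class_eq η

/-- The connecting map `Hom(V ⊗ 𝒪_X, W ⊗ 𝒪_X) → Ext¹(F, W ⊗ 𝒪_X)` is injective, because
`V^* → Ext¹(F, 𝒪_X)` is. -/
lemma eq_zero_of_extClass_comp {W : Type*} [AddCommGroup W] [Module ℂ W] [FiniteDimensional ℂ W]
    (f : tensorO X (Module.Dual ℂ Vstar) ⟶ tensorO X W)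
    (hf : T.exact.extClass.comp (Ext.mk₀ f) (add_zero 1) = 0) : f = 0 := by
  refine hom_ext_contract fun ξ => ?_
  obtain ⟨η, h, h'⟩ := T.exists_comp_contract_eq f ξ
  rw [hf, Ext.zero_comp] at h'
  obtain rfl : η = 0 := Subtype.ext h'.symm
  rw [h, map_zero, zero_comp]
  refine tensor_hom_ext fun x => ?_
  rw [tensorVec_contract]
  simp

/-- `E` is simple. As `H⁰(F) = 0`, an endomorphism `ψ` of `E` induces one of `F`, which is a scalar
`a`. The difference `ψ - a` factors through some `θ : E ⟶ V ⊗ 𝒪_X`. The restriction of `θ` to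
`V ⊗ 𝒪_X` extends to `E`, so that it is killed by the connecting map and hence zero. Therefore `θ`
factors through `F`, and `Hom(F, 𝒪_X) = 0`. -/
lemma isSimple (hF : IsSimple F) (h0 : Subsingleton (H0 F))
    (h0' : Subsingleton (F ⟶ structureSheaf X)) : IsSimple T.E := by
  constructor
  · rw [injective_iff_map_eq_zero]
    intro a ha
    refine (injective_iff_map_eq_zero _).1 hF.1 a ?_
    change globalSMul F a = 0
    rw [← cancel_epi T.p, ← globalSMul_comm, comp_zero]
    change globalSMul T.E a = 0 at ha
    rw [ha, zero_comp]
  · intro ψ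
    obtain ⟨ψ', hψ'⟩ := T.exact.exists_desc (ψ ≫ T.p) (tensorO_hom_eq_zero h0 _)
    obtain ⟨a, ha⟩ := hF.2 ψ'
    refine ⟨a, ?_⟩
    obtain ⟨θ, hθ⟩ := T.exact.exists_lift ((show T.E ⟶ T.E from ψ) - globalSMul T.E a) (by
      change ((show T.E ⟶ T.E from ψ) - globalSMul T.E a) ≫ T.p = 0
      rw [Preadditive.sub_comp, globalSMul_comm, ← hψ', ← ha, sub_eq_zero]
      rfl)
    have h1 : T.i ≫ θ = 0 := by
      refine T.eq_zero_of_extClass_comp _ ?_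
      rw [← Ext.mk₀_comp_mk₀, ← Ext.comp_assoc_of_second_deg_zero]
      rw [T.exact.extClass_comp, Ext.zero_comp]
    obtain ⟨κ, hκ⟩ := T.exact.exists_desc θ h1
    have h2 : κ = 0 := hom_ext_contract fun ξ => Subsingleton.elim _ _
    rw [h2, comp_zero] at hκ
    rw [← hκ, zero_comp] at hθ
    exact (sub_eq_zero.1 hθ.symm).symm

/-- The isomorphism `V ≅ H⁰(E)` induced by `i`, when `H⁰(F) = 0`. -/
def sectionsEquiv (h0 : Subsingleton (H0 F)) : Module.Dual ℂ Vstar ≃ₗ[ℂ] H0 T.E :=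
  LinearEquiv.ofBijective ((Linear.rightComp ℂ (structureSheaf X) T.i).comp tensorVec) <| by
    have h : Function.Bijective (Linear.rightComp ℂ (structureSheaf X) T.i) := by
      constructor
      · intro f g hfg
        exact (cancel_mono T.i).1 hfg
      · intro f
        obtain ⟨g, hg⟩ := T.exact.exists_lift f (Subsingleton.elim (α := H0 F) _ _)
        exact ⟨g, hg⟩
    exact h.comp (tensorVec_bijective X _)

lemma sectionsEquiv_apply (h0 : Subsingleton (H0 F)) (x : Module.Dual ℂ Vstar) :
    T.sectionsEquiv h0 x = tensorVec x ≫ T.i := rfl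

/-- Under `V ≅ H⁰(E)` the evaluation map of `E` becomes `i`. -/
lemma exact_evaluation (h0 : Subsingleton (H0 F)) :
    ∃ (_ : FiniteDimensional ℂ (H0 T.E)) (w : evaluation T.E ≫ T.p = 0),
      (ShortComplex.mk (evaluation T.E) T.p w).ShortExact := by
  let e := T.sectionsEquiv h0
  have : FiniteDimensional ℂ (H0 T.E) := e.finiteDimensional
  have h : (tensorIso e).hom ≫ evaluation T.E = T.i := tensor_hom_ext fun x => by
    rw [← Category.assoc, tensorIso, tensorVec_desc]
    exact tensorVec_desc _ _
  have w : evaluation T.E ≫ T.p = 0 := tensorO_hom_eq_zero h0 _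
  refine ⟨this, w, ?_⟩
  let S := ShortComplex.mk T.i T.p T.zero
  let S' := ShortComplex.mk (evaluation T.E) T.p w
  have α : S ≅ S' := ShortComplex.isoMk (tensorIso e) (Iso.refl _) (Iso.refl _)
    (h.trans (Category.comp_id _).symm)
    ((Category.id_comp _).trans (Category.comp_id _).symm)
  exact ShortComplex.shortExact_of_iso α T.exact

/-- A morphism `θ` of extension bundles maps `V ⊗ 𝒪_X` to `V' ⊗ 𝒪_X` if `H⁰(F') = 0`, and so
descends to some `g : F ⟶ F'`. Naturality of extension classes shows that `g^*` maps `V'^*` to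
`V^*`. -/
lemma exists_hom_quotient {F' : X.Modules} {Vstar' : Submodule ℂ (H1Dual F')}
    [FiniteDimensional ℂ Vstar'] (T' : ExtensionBundle F' Vstar') (h0 : Subsingleton (H0 F'))
    (θ : T.E ⟶ T'.E) :
    ∃ g : F ⟶ F', T.p ≫ g = θ ≫ T'.p ∧
      ∀ ξ ∈ Vstar', (Ext.mk₀ g).comp ξ (zero_add 1) ∈ Vstar := by
  obtain ⟨f, hf⟩ := T'.exact.exists_lift (T.i ≫ θ) (tensorO_hom_eq_zero h0 _)
  obtain ⟨g, hg⟩ := T.exact.exists_desc (θ ≫ T'.p) (tensorO_hom_eq_zero h0 _)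
  refine ⟨g, hg, fun ξ hξ => ?_⟩
  let Φ : ShortComplex.mk T.i T.p T.zero ⟶ ShortComplex.mk T'.i T'.p T'.zero :=
    { τ₁ := f, τ₂ := θ, τ₃ := g, comm₁₂ := hf, comm₂₃ := hg.symm }
  have hΦ : T.exact.extClass.comp (Ext.mk₀ f) (add_zero 1) =
      (Ext.mk₀ g).comp T'.exact.extClass (zero_add 1) := T.exact.extClass_naturality T'.exact Φ
  obtain ⟨η, -, hη⟩ := T.exists_comp_contract_eq f (Module.Dual.eval ℂ Vstar' ⟨ξ, hξ⟩)
  rw [hΦ, Ext.comp_assoc_of_third_deg_zero, T'.class_eq] at hη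
  exact hη ▸ η.2

/-- The pair `(F, V)` can be recovered from its extension bundle. -/
lemma exists_iso_quotient {F' : X.Modules} {Vstar' : Submodule ℂ (H1Dual F')}
    [FiniteDimensional ℂ Vstar'] (T' : ExtensionBundle F' Vstar') (h0 : Subsingleton (H0 F))
    (h0' : Subsingleton (H0 F')) (θ : T.E ≅ T'.E) :
    ∃ φ : F ≅ F', ∀ ξ : H1Dual F', ξ ∈ Vstar' ↔
      (Ext.mk₀ φ.hom).comp ξ (zero_add 1) ∈ Vstar := by
  obtain ⟨g, hg, hgV⟩ := T.exists_hom_quotient T' h0' θ.hom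
  obtain ⟨k, hk, hkV⟩ := T'.exists_hom_quotient T h0 θ.inv
  have hgk : g ≫ k = 𝟙 F := by
    rw [← cancel_epi T.p, reassoc_of% hg, hk, Iso.hom_inv_id_assoc, Category.comp_id]
  have hkg : k ≫ g = 𝟙 F' := by
    rw [← cancel_epi T'.p, reassoc_of% hk, hg, Iso.inv_hom_id_assoc, Category.comp_id]
  refine ⟨⟨g, k, hgk, hkg⟩, fun ξ => ⟨hgV ξ, fun h => ?_⟩⟩
  have := hkV _ h
  rwa [Ext.mk₀_comp_mk₀_assoc, hkg, Ext.mk₀_id_comp] at this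

end ExtensionBundle

end K3Ext

/-! ### Local splittings of extensions of vector bundles -/

universe u v₁ u₁

/-- An epimorphism of sheaves of modules is locally surjective: the inclusion of its presheaf image
becomes both a monomorphism and an epimorphism after sheafification, so it is locally bijective. -/
lemma SheafOfModules.isLocallySurjective_of_epi {C : Type u₁} [Category.{v₁} C]
    {J : GrothendieckTopology C} {R : Sheaf J RingCat.{u}} [HasSheafify J AddCommGrpCat.{u}]
    [J.WEqualsLocallyBijective AddCommGrpCat.{u}] {M N : SheafOfModules.{u} R} (f : M ⟶ N)
    [Epi f] : Presheaf.IsLocallySurjective J ((PresheafOfModules.toPresheaf _).map f.val) := by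
  let α := 𝟙 R.obj
  let adj := PresheafOfModules.sheafificationAdjunction.{u} α
  let a := PresheafOfModules.sheafification.{u} α
  let g := (SheafOfModules.forget R ⋙ PresheafOfModules.restrictScalars α).map f
  let ι := Limits.image.ι g
  let π := Limits.factorThruImage g
  have hadj (K : SheafOfModules R) : IsIso (adj.counit.app K) :=
    inferInstanceAs (IsIso ((PresheafOfModules.sheafificationAdjunction.{u} α).counit.app K))
  have hg : a.map g = adj.counit.app M ≫ f ≫ inv (adj.counit.app N) := by
    rw [← Category.assoc, IsIso.eq_comp_inv]
    exact adj.counit.naturality f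
  have hag : Epi (a.map g) := by rw [hg]; infer_instance
  have hι : Epi (a.map ι) := by
    rw [← Limits.image.fac g, a.map_comp] at hag
    exact epi_of_epi (a.map π) _
  have hι' : IsIso (a.map ι) := isIso_of_mono_of_epi _
  have hW : J.W ((PresheafOfModules.toPresheaf _).map ι) := by
    rw [GrothendieckTopology.W_iff]
    exact inferInstanceAs (IsIso ((SheafOfModules.toSheaf _).map (a.map ι)))
  have h1 : Presheaf.IsLocallySurjective J ((PresheafOfModules.toPresheaf _).map ι) :=
    ((J.W_iff_isLocallyBijective _).1 hW).2
  have h2 : Presheaf.IsLocallySurjective J ((PresheafOfModules.toPresheaf _).map π) :=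
    Presheaf.isLocallySurjective_of_surjective J _
      fun U => PresheafOfModules.surjective_of_epi π U
  have h3 : Presheaf.IsLocallySurjective J ((PresheafOfModules.toPresheaf _).map π ≫
      (PresheafOfModules.toPresheaf _).map ι) := Presheaf.isLocallySurjective_comp J _ _
  rw [← Functor.map_comp, Limits.image.fac] at h3
  exact h3

namespace AlgebraicGeometry.Scheme.Modules

lemma isLocallySurjective_mapPresheaf {X : Scheme.{u}} {M N : X.Modules} (f : M ⟶ N) [Epi f] :
    TopCat.Presheaf.IsLocallySurjective f.mapPresheaf :=
  let f' : (M : SheafOfModules X.ringCatSheaf) ⟶ N := f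
  @SheafOfModules.isLocallySurjective_of_epi _ _ _ _ _ _ _ _ f' ‹Epi f›

lemma mono_iff_injective_app {X : Scheme.{u}} {M N : X.Modules} (f : M ⟶ N) :
    Mono f ↔ ∀ U, Function.Injective (f.app U) := by
  rw [← (toPresheaf X).mono_map_iff_mono, NatTrans.mono_iff_mono_app]
  simp only [AddCommGrpCat.mono_iff_injective]
  exact ⟨fun h U => h (.op U), fun h U => h U.unop⟩

instance {X Y : Scheme.{u}} (f : X ⟶ Y) [IsOpenImmersion f] : (restrictFunctor f).Additive where
  map_add := rfl

lemma shortExact_restrict {X Y : Scheme.{u}} (f : X ⟶ Y) [IsOpenImmersion f]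
    {S : ShortComplex Y.Modules} (hS : S.ShortExact) : (S.map (restrictFunctor f)).ShortExact := by
  have := hS.mono_f
  have := hS.epi_g
  exact
    { exact := hS.exact.map_of_epi_of_preservesCokernel _ inferInstance inferInstance
      mono_f := (mono_iff_injective_app _).2 fun U => (mono_iff_injective_app S.f).1 hS.mono_f _
      epi_g := inferInstanceAs (Epi ((restrictFunctor f).map S.g)) }

end AlgebraicGeometry.Scheme.Modules

namespace K3Ext

/-- `𝒪^(m+n) ≅ 𝒪^m ⊕ 𝒪^n`. -/
def trivialBundleAddIso (X : Scheme.{0}) (m n : ℕ) :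
    trivialBundle X (m + n) ≅ trivialBundle X m ⊞ trivialBundle X n where
  hom := Sigma.desc (Fin.addCases
    (fun i => Sigma.ι (fun _ : Fin m => structureSheaf X) i ≫ biprod.inl)
    (fun i => Sigma.ι (fun _ : Fin n => structureSheaf X) i ≫ biprod.inr))
  inv := biprod.desc
    (Sigma.desc fun i => Sigma.ι (fun _ : Fin (m + n) => structureSheaf X) (Fin.castAdd n i))
    (Sigma.desc fun i => Sigma.ι (fun _ : Fin (m + n) => structureSheaf X) (Fin.natAdd m i))
  hom_inv_id := by
    refine Sigma.hom_ext _ _ fun i => ?_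
    induction i using Fin.addCases <;> simp
  inv_hom_id := by
    refine biprod.hom_ext' _ _ (Sigma.hom_ext _ _ fun i => ?_) (Sigma.hom_ext _ _ fun i => ?_) <;>
    simp

/-- The restriction of `𝒪_Y^n` along an open immersion `X ⟶ Y` is `𝒪_X^n`. -/
def restrictTrivialBundleIso {X Y : Scheme.{0}} (f : X ⟶ Y) [IsOpenImmersion f] (n : ℕ) :
    (trivialBundle Y n).restrict f ≅ trivialBundle X n :=
  PreservesCoproduct.iso (Scheme.Modules.restrictFunctor f) _ ≪≫
    Sigma.mapIso fun _ => Scheme.Modules.restrictUnitIso f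

lemma ι_restrictTrivialBundleIso_inv {X Y : Scheme.{0}} (f : X ⟶ Y) [IsOpenImmersion f] (n : ℕ)
    (i : Fin n) : Sigma.ι (fun _ : Fin n => structureSheaf X) i ≫ (restrictTrivialBundleIso f n).inv
      = (Scheme.Modules.restrictUnitIso f).inv ≫
        (Scheme.Modules.restrictFunctor f).map (Sigma.ι (fun _ : Fin n => structureSheaf Y) i) := by
  simp [restrictTrivialBundleIso]

/-- Local triviality may be tested on open immersions in place of open subschemes. -/
lemma isVectorBundle_of_openImmersion {X : Scheme.{0}} {M : X.Modules} {r : ℕ}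
    (h : ∀ x : X, ∃ (Y : Scheme.{0}) (f : Y ⟶ X) (_ : IsOpenImmersion f),
      x ∈ Set.range f ∧ Nonempty (M.restrict f ≅ trivialBundle Y r)) : IsVectorBundle M r := by
  intro x
  obtain ⟨Y, f, hf, hx, ⟨e⟩⟩ := h x
  refine ⟨f.opensRange, hx, ⟨?_⟩⟩
  have h1 : f.isoOpensRange.inv ≫ f = f.opensRange.ι := by simp
  exact (Scheme.Modules.restrictFunctorCongr h1).symm.app M ≪≫
    (Scheme.Modules.restrictFunctorComp f.isoOpensRange.inv f).app M ≪≫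
    (Scheme.Modules.restrictFunctor f.isoOpensRange.inv).mapIso e ≪≫
    restrictTrivialBundleIso f.isoOpensRange.inv r

/-- An epimorphism onto `𝒪^n` splits locally: lift the `n` basis sections near the given
point. -/
lemma exists_restrict_section {Y : Scheme.{0}} {E : Y.Modules} {n : ℕ}
    (p : E ⟶ trivialBundle Y n) [Epi p] (y : Y) :
    ∃ U : Y.Opens, y ∈ U ∧ ∃ s : (trivialBundle Y n).restrict U.ι ⟶ E.restrict U.ι,
      s ≫ (Scheme.Modules.restrictFunctor U.ι).map p = 𝟙 _ := by
  have hp := (TopCat.Presheaf.isLocallySurjective_iff _).1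
    (Scheme.Modules.isLocallySurjective_mapPresheaf p) ⊤
  choose W hW t hy using fun i : Fin n => hp (globalSectionsEquiv _
    (Sigma.ι (fun _ : Fin n => structureSheaf Y) i)) y trivial
  choose t ht using t
  -- All basis sections lift to `U`, and the lifts define the splitting.
  let U : Y.Opens := ⨅ i, W i
  have hU (i : Fin n) : U.ι ''ᵁ ⊤ ≤ W i := by
    simpa [U] using iInf_le W i
  refine ⟨U, ?_, (restrictTrivialBundleIso U.ι n).hom ≫ Sigma.desc fun i =>
    (globalSectionsEquiv (E.restrict U.ι)).symm (E.presheaf.map (homOfLE (hU i)).op (t i)), ?_⟩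
  · rw [← SetLike.mem_coe, TopologicalSpace.Opens.coe_iInf]
    exact Set.mem_iInter.2 hy
  · rw [← cancel_epi (restrictTrivialBundleIso U.ι n).inv]
    refine Sigma.hom_ext _ _ fun i => ?_
    rw [Category.comp_id, ι_restrictTrivialBundleIso_inv, Category.assoc, Iso.inv_hom_id_assoc,
      Sigma.ι_desc_assoc]
    apply (globalSectionsEquiv _).injective
    have h0 := (globalSectionsEquiv (E.restrict U.ι)).apply_symm_apply
      (E.presheaf.map (homOfLE (hU i)).op (t i))
    refine (congrArg (p.app (U.ι ''ᵁ ⊤)) h0).trans ?_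
    change (p.app _) (E.presheaf.map (homOfLE (hU i)).op (t i)) =
      (Scheme.Modules.Hom.app (Sigma.ι (fun _ : Fin n => structureSheaf Y) i) (U.ι ''ᵁ ⊤)) ((U.ι.appIso ⊤).inv 1)
    let ι : structureSheaf Y ⟶ trivialBundle Y n := Sigma.ι (fun _ : Fin n => structureSheaf Y) i
    have h1 : p.app (W i) (t i) = (trivialBundle Y n).presheaf.map (homOfLE (hW i)).op
      (ι.app ⊤ (1 : Γ(Y, ⊤))) := ht i
    have h2 := ConcreteCategory.congr_hom
      (p.mapPresheaf.naturality (homOfLE (hU i)).op) (t i)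
    have h3 := ConcreteCategory.congr_hom
      (ι.mapPresheaf.naturality (homOfLE (le_top : U.ι ''ᵁ ⊤ ≤ ⊤)).op) (1 : Γ(Y, ⊤))
    have h4 : (1 : Γ(Y, U.ι ''ᵁ ⊤)) = Y.presheaf.map (homOfLE le_top).op 1 := (map_one _).symm
    rw [map_one]
    refine h2.trans ((congrArg ((trivialBundle Y n).presheaf.map (homOfLE (hU i)).op) h1).trans ?_)
    refine Eq.trans ?_ (h3.symm.trans (congrArg (ι.app (U.ι ''ᵁ ⊤)) h4.symm))
    rw [← ConcreteCategory.comp_apply, ← Functor.map_comp]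
    rfl

/-- An extension of a vector bundle by a trivial bundle is a vector bundle, as it splits
locally. -/
lemma isVectorBundle_of_shortExact {X : Scheme.{0}} {S : ShortComplex X.Modules}
    (hS : S.ShortExact) {m n : ℕ} (e : S.X₁ ≅ trivialBundle X m) (h : IsVectorBundle S.X₃ n) :
    IsVectorBundle S.X₂ (n + m) := by
  refine isVectorBundle_of_openImmersion fun x => ?_
  obtain ⟨U, hx, ⟨e'⟩⟩ := h x
  let R := Scheme.Modules.restrictFunctor U.ι
  have hSU : (S.map R).ShortExact := Scheme.Modules.shortExact_restrict U.ι hS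
  have hg : Epi (R.map S.g) := hSU.epi_g
  obtain ⟨V, hV, s, hs⟩ := exists_restrict_section (R.map S.g ≫ e'.hom) ⟨x, hx⟩
  let R' := Scheme.Modules.restrictFunctor V.ι
  have hSV : ((S.map R).map R').ShortExact := Scheme.Modules.shortExact_restrict V.ι hSU
  have hs' : (R'.map e'.hom ≫ s) ≫ R'.map (R.map S.g) = 𝟙 _ := by
    rw [← cancel_mono (R'.map e'.hom)]
    rw [Functor.map_comp] at hs
    rw [Category.assoc, Category.assoc, hs, Category.comp_id, Category.id_comp]
  have σ := ShortComplex.Splitting.ofExactOfSection _ hSV.exact _ hs' hSV.mono_f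
  refine ⟨V, V.ι ≫ U.ι, inferInstance, ⟨⟨⟨x, hx⟩, hV⟩, rfl⟩, ⟨?_⟩⟩
  exact (Scheme.Modules.restrictFunctorComp V.ι U.ι).app S.X₂ ≪≫ σ.isoBinaryBiproduct ≪≫
    biprod.braiding _ _ ≪≫
    biprod.mapIso (R'.mapIso e' ≪≫ restrictTrivialBundleIso V.ι n)
      (R'.mapIso (R.mapIso e ≪≫ restrictTrivialBundleIso U.ι m) ≪≫
        restrictTrivialBundleIso V.ι m) ≪≫ (trivialBundleAddIso V n m).symm

lemma IsVectorBundle.hasRank {X : Scheme.{0}} [Nonempty X] {M : X.Modules} {r : ℕ}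
    (h : IsVectorBundle M r) : HasRank M r :=
  have ⟨U, hU, e⟩ := h (Classical.arbitrary X)
  ⟨U, ⟨_, hU⟩, e⟩

lemma isVectorBundle_trivialBundle (X : Scheme.{0}) (n : ℕ) :
    IsVectorBundle (trivialBundle X n) n :=
  fun _ => ⟨⊤, trivial, ⟨restrictTrivialBundleIso _ n⟩⟩

end K3Ext

/-! ### Coherence and Chern classes of vector bundles -/

/-- The presentation of a free sheaf of modules without relations. -/
def SheafOfModules.free.presentation {C : Type u₁} [Category.{v₁} C]
    {J : GrothendieckTopology C} (R : Sheaf J RingCat.{u}) [HasSheafify J AddCommGrpCat.{u}]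
    [J.WEqualsLocallyBijective AddCommGrpCat.{u}] (I : Type u) :
    (SheafOfModules.free (R := R) I).Presentation where
  generators := free.generatingSections I
  relations.I := ULift Empty
  relations.s j := Empty.rec _ j.down
  relations.epi := IsZero.epi (IsZero.of_iso (isZero_zero _) (Limits.kernel.ofMono _)) _

namespace K3Ext

/-- The restriction of `M` to the open subscheme `U` corresponds to the restriction of `M` to the
slice site over `U`. -/
def overIso {X : Scheme.{0}} (M : X.Modules) (U : X.Opens) :
    (Scheme.Modules.overEquiv U).inverse.obj (M.restrict U.ι) ≅
      (M : SheafOfModules X.ringCatSheaf).over U :=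
  (Scheme.Modules.overEquiv U).inverse.mapIso
    ((Scheme.Modules.overFunctorEquiv U).symm.app M) ≪≫
    (Scheme.Modules.overEquiv U).unitIso.symm.app _

/-- The trivial bundle on the open subscheme `U` corresponds to the free sheaf on the slice site
over `U`. -/
def overTrivialBundleIso {X : Scheme.{0}} (U : X.Opens) (n : ℕ) :
    SheafOfModules.free (R := X.ringCatSheaf.over U) (Fin n) ≅
      (Scheme.Modules.overEquiv U).inverse.obj (trivialBundle U n) :=
  (Sigma.mapIso fun _ => (overIso (structureSheaf X) U).symm ≪≫
    (Scheme.Modules.overEquiv U).inverse.mapIso (Scheme.Modules.restrictUnitIso U.ι)) ≪≫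
    (PreservesCoproduct.iso (Scheme.Modules.overEquiv U).inverse _).symm

/-- Vector bundles are coherent. -/
lemma IsVectorBundle.isFinitePresentation {X : Scheme.{0}} {M : X.Modules} {r : ℕ}
    (h : IsVectorBundle M r) :
    SheafOfModules.IsFinitePresentation (M : SheafOfModules X.ringCatSheaf) := by
  choose U hU e using h
  let P (x : X) := ((SheafOfModules.free.presentation (X.ringCatSheaf.over (U x)) (Fin r)).ofIsIso
    (overTrivialBundleIso (U x) r ≪≫
      (Scheme.Modules.overEquiv (U x)).inverse.mapIso (e x).some.symm ≪≫ overIso M (U x)).hom)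
  let q : SheafOfModules.QuasicoherentData (M : SheafOfModules X.ringCatSheaf) :=
    { I := X
      X := U
      coversTop := by
        rw [_root_.Opens.coversTop_iff, TopologicalSpace.IsOpenCover]
        exact top_le_iff.1 fun x _ => TopologicalSpace.Opens.mem_iSup.2 ⟨x, hU x⟩
      presentation := P }
  have hP (x : X) : (P x).IsFinite := by
    have : (SheafOfModules.free.presentation (X.ringCatSheaf.over (U x)) (Fin r)).IsFinite :=
      { isFiniteType_generators := ⟨inferInstanceAs (Finite (Fin r))⟩
        isFiniteType_relations := ⟨inferInstanceAs (Finite (ULift Empty))⟩ }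
    infer_instance
  exact ⟨q, ⟨hP⟩⟩

/-- `𝒪_X^n` as a coherent sheaf. -/
def trivialCoh (X : Scheme.{0}) (n : ℕ) : Coh X :=
  ⟨trivialBundle X n, (isVectorBundle_trivialBundle X n).isFinitePresentation⟩

variable {X : Scheme.{0}} [X.Over SpecC]

lemma numClass_of_shortExact {A B C : Coh X} {f : A.1 ⟶ B.1} {g : B.1 ⟶ C.1} {w : f ≫ g = 0}
    (h : (ShortComplex.mk f g w).ShortExact) : numClass B = numClass A + numClass C := by
  rw [← sub_eq_zero, ← sub_sub]
  refine (QuotientAddGroup.eq_zero_iff _).2 (AddSubgroup.mem_sup_left ?_)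
  exact AddSubgroup.subset_closure ⟨A, B, C, f, g, w, h, rfl⟩

lemma numClass_eq_zero {Z : Coh X} (hZ : IsZero Z.1) : numClass Z = 0 := by
  have h : (ShortComplex.mk (𝟙 Z.1) (0 : Z.1 ⟶ Z.1) (hZ.eq_of_src _ _)).ShortExact :=
    { exact := ShortComplex.exact_of_isZero_X₂ _ hZ
      mono_f := inferInstanceAs (Mono (𝟙 Z.1))
      epi_g := hZ.epi _ }
  simpa using numClass_of_shortExact h

lemma numClass_trivialCoh (n : ℕ) :
    numClass (trivialCoh X n) = n • numClass (structureCoh X) := by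
  induction n with
  | zero =>
    rw [zero_smul]
    exact numClass_eq_zero
      ((IsZero.iff_id_eq_zero _).2 (Sigma.hom_ext _ _ fun i : Fin 0 => i.elim0))
  | succ n ih =>
    let e : trivialBundle X (n + 1) ≅ trivialBundle X n ⊞ structureSheaf X :=
      trivialBundleAddIso X n 1 ≪≫ biprod.mapIso (Iso.refl _) (coproductUniqueIso _)
    have h : (ShortComplex.mk (biprod.inl ≫ e.inv) (e.hom ≫ biprod.snd)
      (by simp)).ShortExact := ShortComplex.Splitting.shortExact
        { r := e.hom ≫ biprod.fst
          s := biprod.inr ≫ e.inv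
          f_r := by simp
          s_g := by simp
          id := by
            rw [← cancel_epi e.inv, ← cancel_mono e.hom]
            simp [biprod.total] }
    rw [numClass_of_shortExact (A := trivialCoh X n) (B := trivialCoh X (n + 1))
      (C := structureCoh X) h, ih, succ_nsmul]

/-- An extension by `𝒪^n` has the same Chern classes. -/
lemma chern_of_shortExact {E F : Coh X} {n : ℕ} {i : trivialBundle X n ⟶ E.1} {p : E.1 ⟶ F.1}
    {w : i ≫ p = 0} (h : (ShortComplex.mk i p w).ShortExact) (r : ℕ) :
    chern E (r + n) = chern F r := by
  rw [chern, chern, numClass_of_shortExact (A := trivialCoh X n) h, numClass_trivialCoh, add_smul]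
  abel

end K3Ext

/-! ### The map on points -/

namespace K3Ext

namespace ExtensionBundle

variable {X : Scheme.{0}} [X.Over SpecC]

lemma isVectorBundle {F : X.Modules} {Vstar : Submodule ℂ (H1Dual F)} [FiniteDimensional ℂ Vstar]
    (T : ExtensionBundle F Vstar) {r v : ℕ} (hF : IsVectorBundle F r)
    (hv : Module.finrank ℂ Vstar = v) : IsVectorBundle T.E (r + v) := by
  rw [← hv, ← Subspace.dual_finrank_eq]
  exact isVectorBundle_of_shortExact T.exact (Iso.refl _) hF

lemma mk_mem_Spl [IsK3 X] {F : Coh X} {Vstar : Submodule ℂ (H1Dual F.1)}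
    [FiniteDimensional ℂ Vstar] (T : ExtensionBundle F.1 Vstar) {r v : ℕ} {c : NumK X}
    (hF : MemUe r c F) (hv : Module.finrank ℂ Vstar = v) :
    (Quotient.mk _ T.E : IsoClass X) ∈ Spl X (r + v) c := by
  have : Nonempty X := (IsK3.connected (X := X)).toNonempty
  have hE := T.isVectorBundle hF.bundle hv
  have hE' := hE.isFinitePresentation
  refine ⟨⟨T.E, hE'⟩, T.isSimple hF.simple hF.h0 hF.h0_dual, hE.hasRank,
    ?_, rfl⟩
  rw [← hF.chern_eq, ← hv, ← Subspace.dual_finrank_eq]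
  exact chern_of_shortExact (E := ⟨T.E, hE'⟩) (F := F) T.exact r

end ExtensionBundle

/-- The map `β`, which sends `(F, V)` to the isomorphism class of its extension bundles. -/
def beta (X : Scheme.{0}) [X.Over SpecC] [IsK3 X] (r v : ℕ) (c : NumK X) :
    PUe X r v c → Spl X (r + v) c :=
  Quotient.lift
    (fun D => ⟨Quotient.mk _ (nonempty_extensionBundle D.F.1 D.Vstar).some.E,
      ExtensionBundle.mk_mem_Spl _ D.mem D.dim⟩)
    fun _ _ ⟨φ, hφ⟩ => Subtype.ext (Quotient.sound (ExtensionBundle.nonempty_iso _ _ φ hφ))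

variable {X : Scheme.{0}} [X.Over SpecC] [IsK3 X] {r v : ℕ} {c : NumK X}

lemma beta_mk {D : ExtPair X r v c} (T : ExtensionBundle D.F.1 D.Vstar) :
    (beta X r v c (Quotient.mk _ D) : IsoClass X) = Quotient.mk _ T.E :=
  have ⟨φ, hφ⟩ := Setoid.refl D
  Quotient.sound (ExtensionBundle.nonempty_iso _ T φ hφ)

lemma beta_injective : Function.Injective (beta X r v c) := by
  rintro ⟨D⟩ ⟨D'⟩ h
  obtain ⟨T⟩ := nonempty_extensionBundle D.F.1 D.Vstar
  obtain ⟨T'⟩ := nonempty_extensionBundle D'.F.1 D'.Vstar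
  have h' : (Quotient.mk _ T.E : IsoClass X) = Quotient.mk _ T'.E :=
    (beta_mk T).symm.trans ((congrArg Subtype.val h).trans (beta_mk T'))
  obtain ⟨θ⟩ := Quotient.exact h'
  exact Quotient.sound (T.exists_iso_quotient T' D.mem.h0 D'.mem.h0 θ)

end K3Ext

end

theorem mainTheorem8 (X : AlgebraicGeometry.Scheme.{0}) [X.Over K3Ext.SpecC] [K3Ext.IsK3 X]
    (r v : ℕ) (hv : 1 ≤ v) (c : K3Ext.NumK X) :
    (∀ D : K3Ext.ExtPair X r v c, Nonempty (K3Ext.ExtensionBundle D.F.1 D.Vstar)) ∧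
    ∃ β : K3Ext.PUe X r v c → K3Ext.Spl X (r + v) c,
      (∀ (D : K3Ext.ExtPair X r v c) (T : K3Ext.ExtensionBundle D.F.1 D.Vstar),
        K3Ext.IsVectorBundle T.E (r + v) ∧
        (β (Quotient.mk _ D) : K3Ext.IsoClass X) = Quotient.mk _ T.E) ∧
      Function.Injective β ∧
      ∀ (D : K3Ext.ExtPair X r v c) (T : K3Ext.ExtensionBundle D.F.1 D.Vstar),
        (∃ e : Module.Dual ℂ D.Vstar ≃ₗ[ℂ] K3Ext.H0 T.E,
          ∀ x : Module.Dual ℂ D.Vstar, e x = K3Ext.tensorVec x ≫ T.i) ∧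
        ∃ (_ : FiniteDimensional ℂ (K3Ext.H0 T.E)) (w : K3Ext.evaluation T.E ≫ T.p = 0),
          (ShortComplex.mk (K3Ext.evaluation T.E) T.p w).ShortExact := by
  refine ⟨fun D => K3Ext.nonempty_extensionBundle _ _, K3Ext.beta X r v c, fun D T => ?_,
    K3Ext.beta_injective, fun D T => ?_⟩
  · exact ⟨T.isVectorBundle D.mem.bundle D.dim, K3Ext.beta_mk T⟩
  · exact ⟨⟨T.sectionsEquiv D.mem.h0, T.sectionsEquiv_apply D.mem.h0⟩,
      T.exact_evaluation D.mem.h0⟩
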